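/- **Model.** Let $\varepsilon_1,\varepsilon_2,\dots$ be i.i.d. copies of a centered second order process $\varepsilon=(\varepsilon(t))_{t\in[0,1]}$ with autocovariance function $R$, and let $Y_j(t)=g(t)+\varepsilon_j(t)$ with $g\in C^2([0,1])$. Assume that for every finite $T\subset[0,1]$ the matrix $(R(s,t))_{s,t\in T}$ is non-singular, and that: (A) $R$ is continuous on $[0,1]^2$ and has continuous derivatives up to order two at the points $(s,t)\in[0,1]^2$ with $s\neq t$; for $i=1,2$ the limits $R^{(0,i)}(t,t^-)=\lim_{s\uparrow t}\frac{\partial^i R(t,s)}{\partial s^i}$ ($0<t\le 1$) and $R^{(0,i)}(t,t^+)=\lim_{s\downarrow t}\frac{\partial^i R(t,s)}{\partial s^i}$ ($0\le t<1$) exist and are continuous in $t$. (B) The function $\alpha(t)=R^{(0,1)}(t,t^-)-R^{(0,1)}(t,t^+)$ is Lipschitz on $]0,1[$, with $\inf_{0<t<1}\alpha(t)>0$ and $\sup_{0<t<1}\alpha(t)<\infty$. (C) For each $t\in[0,1[$ the function $R^{(0,2)}(\cdot,t^+)$ belongs to the reproducing kernel Hilbert space of functions on $[0,1]$ with reproducing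 kernel $R$, and its norm there is bounded uniformly in $t$. (D) $K:\mathbb R\to\mathbb R$ vanishes outside $[-1,1]$, is $C^1$ on $[-1,1]$ and even, $K'$ is Lipschitz on $[-1,1]$, $\int_{-1}^1K(t)\,dt=1$, $\int_{-1}^1tK(t)\,dt=0$ and $\int_{-1}^1t^2K(t)\,dt$ is finite. **Design.** Let $f\in C^2([0,1])$ be a probability density on $[0,1]$ with $\inf_{0<t<1}f(t)>0$ and $\sup_{0<t<1}f(t)<\infty$, let $F(t)=\int_0^tf(u)\,du$, and let $t_{i,n}=F^{-1}(i/n)$ for $i=1,\dots,n$. **Estimator.** For $x\in[0,1]$ and $h\in]0,1[$ let $\varphi_{x,h}(s)=\frac1hK\big(\frac{x-s}h\big)$ and $f_{x,h}(t)=\int_0^1R(s,t)\varphi_{x,h}(s)\,ds$. The projection estimator from $n$ design points and $m$ experimental units is $$\hat g_n^{pro}(x)=\sum_{i=1}^n m_{x,h}(t_{i,n})\,\overline Y(t_{i,n}),\qquad \overline Y(t)=\frac1m\sum_{j=1}^mY_j(t),$$ where the row vector of weights is $\big(m_{x,h}(t_{i,n})\big)_{i}=\big(f_{x,h}(t_{i,n})\big)_{i}\,\Big(\big(R(t_{i,n},t_{j,n})\big)_{i,j}\Big)^{-1}$.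 **Theorem.** Let $n,m\to\infty$ along a sequence of pairs $(n,m)$ of positive integers, with bandwidths $h\in]0,1[$, such that $h\to0$, $nh\to\infty$, $\frac nm=O(1)$, $nh^2\to\infty$ and $\sqrt m\,h^2\to0$. Then for every $x\in]0,1[$, $$\sqrt m\,\big(\hat g_n^{pro}(x)-g(x)\big)\ \longrightarrow\ \mathcal N\big(0,R(x,x)\big)\quad\text{in distribution.}$$ -/

import Mathlib

open MeasureTheory ProbabilityTheory Filter Topology Set

noncomputable section

namespace ProjEst

/-! ### The autocovariance function and its one-sided derivatives -/

/-- `R^{(0,1)}(s,t)`: the partial derivative in the second variable on `[0,1]`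
(one-sided at the end points `t = 0` and `t = 1`). -/
def d01 (R : ℝ → ℝ → ℝ) (s t : ℝ) : ℝ :=
  derivWithin (fun u => R s u) (Icc 0 1) t

/-- `R^{(0,2)}(s,t)`: the second partial derivative in the second variable on `[0,1]`. -/
def d02 (R : ℝ → ℝ → ℝ) (s t : ℝ) : ℝ :=
  derivWithin (fun u => d01 R s u) (Icc 0 1) t

/-- `R^{(0,1)}(s,t⁻)`, the limit of `R^{(0,1)}(s,u)` as `u ↑ t`. -/
def d01Left (R : ℝ → ℝ → ℝ) (s t : ℝ) : ℝ := Function.leftLim (d01 R s) t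

/-- `R^{(0,1)}(s,t⁺)`, the limit of `R^{(0,1)}(s,u)` as `u ↓ t`. -/
def d01Right (R : ℝ → ℝ → ℝ) (s t : ℝ) : ℝ := Function.rightLim (d01 R s) t

/-- `R^{(0,2)}(s,t⁻)`, the limit of `R^{(0,2)}(s,u)` as `u ↑ t`. -/
def d02Left (R : ℝ → ℝ → ℝ) (s t : ℝ) : ℝ := Function.leftLim (d02 R s) t

/-- `R^{(0,2)}(s,t⁺)`, the limit of `R^{(0,2)}(s,u)` as `u ↓ t`. -/
def d02Right (R : ℝ → ℝ → ℝ) (s t : ℝ) : ℝ := Function.rightLim (d02 R s) t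

/-- The jump function `α(t) = R^{(0,1)}(t,t⁻) - R^{(0,1)}(t,t⁺)`, used for `0 < t < 1`. -/
def jump (R : ℝ → ℝ → ℝ) (t : ℝ) : ℝ := d01Left R t t - d01Right R t t

/-- Every matrix `(R(s,t))_{s,t ∈ T}` with `T ⊆ [0,1]` finite is non-singular. -/
def Nonsingular (R : ℝ → ℝ → ℝ) : Prop :=
  ∀ T : Finset ℝ, (T : Set ℝ) ⊆ Icc 0 1 →
    IsUnit (Matrix.of (fun s t : T => R s t)).det

/-- Assumption (A). `R` is continuous on the unit square, has continuous derivatives up to order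
two off the diagonal, and the one-sided limits of `R^{(0,1)}(t,·)` and `R^{(0,2)}(t,·)` at the
diagonal exist and are continuous functions of `t` (wherever they make sense inside `[0,1]`). -/
structure AssumptionA (R : ℝ → ℝ → ℝ) : Prop where
  continuousOn : ContinuousOn (fun p : ℝ × ℝ => R p.1 p.2) (Icc 0 1 ×ˢ Icc 0 1)
  offDiag : ContDiffOn ℝ 2 (fun p : ℝ × ℝ => R p.1 p.2)
    {p | p.1 ∈ Icc (0 : ℝ) 1 ∧ p.2 ∈ Icc (0 : ℝ) 1 ∧ p.1 ≠ p.2}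
  left1 : ∀ t ∈ Ioc (0 : ℝ) 1, ∃ l, Tendsto (d01 R t) (𝓝[<] t) (𝓝 l)
  right1 : ∀ t ∈ Ico (0 : ℝ) 1, ∃ l, Tendsto (d01 R t) (𝓝[>] t) (𝓝 l)
  left2 : ∀ t ∈ Ioc (0 : ℝ) 1, ∃ l, Tendsto (d02 R t) (𝓝[<] t) (𝓝 l)
  right2 : ∀ t ∈ Ico (0 : ℝ) 1, ∃ l, Tendsto (d02 R t) (𝓝[>] t) (𝓝 l)
  left1_cont : ContinuousOn (fun t => d01Left R t t) (Ioc 0 1)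
  right1_cont : ContinuousOn (fun t => d01Right R t t) (Ico 0 1)
  left2_cont : ContinuousOn (fun t => d02Left R t t) (Ioc 0 1)
  right2_cont : ContinuousOn (fun t => d02Right R t t) (Ico 0 1)

/-- Assumption (B). The jump function is Lipschitz on `]0,1[`, bounded, and bounded away
from `0`. -/
structure AssumptionB (R : ℝ → ℝ → ℝ) : Prop where
  lipschitz : ∃ L, LipschitzOnWith L (jump R) (Ioo 0 1)
  inf_pos : ∃ α₀ > 0, ∀ t ∈ Ioo (0 : ℝ) 1, α₀ ≤ jump R t
  bddAbove : BddAbove (jump R '' Ioo 0 1)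

/-- Assumption (C). In the reproducing kernel Hilbert space `H` of functions on `[0,1]` whose
reproducing kernel is `R`, the functions `R^{(0,2)}(·,t⁺)` are elements of uniformly bounded
norm. (The right limit `t⁺` makes sense for `t < 1`.) -/
def AssumptionC (R : ℝ → ℝ → ℝ) : Prop :=
  ∃ (H : Type) (_ : NormedAddCommGroup H) (_ : InnerProductSpace ℝ H) (_ : CompleteSpace H)
    (_ : RKHS ℝ H (Icc (0 : ℝ) 1) ℝ),
    (∀ s t : Icc (0 : ℝ) 1, RKHS.kernel H s t 1 = R s t) ∧
    ∃ M : ℝ, ∀ t ∈ Ico (0 : ℝ) 1, ∃ ρ : H,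
      (∀ s : Icc (0 : ℝ) 1, ρ s = d02Right R s t) ∧ ‖ρ‖ ≤ M

/-! ### The error processes -/

/-- `ε 0, ε 1, …` are i.i.d. centered second order processes on `[0,1]` with autocovariance
function `R`. -/
structure IsErrorSequence {Ω : Type*} [MeasurableSpace Ω] (P : Measure Ω)
    (ε : ℕ → ℝ → Ω → ℝ) (R : ℝ → ℝ → ℝ) : Prop where
  measurable : ∀ j, ∀ t ∈ Icc (0 : ℝ) 1, Measurable (ε j t)
  indep : iIndepFun (fun j ω (t : Icc (0 : ℝ) 1) => ε j t ω) P
  ident : ∀ j, IdentDistrib (fun ω (t : Icc (0 : ℝ) 1) => ε j t ω)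
    (fun ω (t : Icc (0 : ℝ) 1) => ε 0 t ω) P P
  memLp : ∀ t ∈ Icc (0 : ℝ) 1, MemLp (ε 0 t) 2 P
  centered : ∀ t ∈ Icc (0 : ℝ) 1, ∫ ω, ε 0 t ω ∂P = 0
  cov_eq : ∀ s ∈ Icc (0 : ℝ) 1, ∀ t ∈ Icc (0 : ℝ) 1, cov[ε 0 s, ε 0 t; P] = R s t

/-! ### The kernel -/

/-- A first order kernel with support in `[-1,1]`, of class `C¹` on `[-1,1]`. -/
structure IsFirstOrderKernel (K : ℝ → ℝ) : Prop where
  support : ∀ u, u ∉ Icc (-1 : ℝ) 1 → K u = 0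
  contDiffOn : ContDiffOn ℝ 1 K (Icc (-1) 1)
  integral_eq_one : ∫ u in (-1 : ℝ)..1, K u = 1
  integral_id_mul : ∫ u in (-1 : ℝ)..1, u * K u = 0
  integrable_sq_mul : IntervalIntegrable (fun u => u ^ 2 * K u) volume (-1) 1

/-- Assumption (D). `K` is even and `K'` is Lipschitz on `[-1,1]`. -/
structure AssumptionD (K : ℝ → ℝ) : Prop where
  even : Function.Even K
  lipschitz_deriv : ∃ L, LipschitzOnWith L (derivWithin K (Icc (-1) 1)) (Icc (-1) 1)

/-! ### The regular sequence of designs -/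

/-- `f` is a `C²` probability density on `[0,1]`, bounded, and bounded away from `0`. -/
structure IsDesignDensity (f : ℝ → ℝ) : Prop where
  contDiffOn : ContDiffOn ℝ 2 f (Icc 0 1)
  inf_pos : ∃ c > 0, ∀ t ∈ Ioo (0 : ℝ) 1, c ≤ f t
  bddAbove : BddAbove (f '' Ioo 0 1)
  integral_eq_one : ∫ t in (0 : ℝ)..1, f t = 1

/-- The distribution function `F` of the density `f` on `[0,1]`. -/
def cdf (f : ℝ → ℝ) (u : ℝ) : ℝ := ∫ v in (0 : ℝ)..u, f v

/-- The design points `t_{i,n} = F⁻¹(i/n)`, `i = 1, …, n`; the index `i : Fin n` stands for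
`i + 1`, and `F⁻¹` is the inverse of `F` on `[0,1]`. -/
def designPoint (f : ℝ → ℝ) (n : ℕ) (i : Fin n) : ℝ :=
  Function.invFunOn (cdf f) (Icc 0 1) (((i : ℕ) + 1 : ℝ) / n)

/-! ### The projection estimator -/

/-- `φ_{x,h}(s) = h⁻¹ K((x - s)/h)`. -/
def phi (K : ℝ → ℝ) (x h s : ℝ) : ℝ := 1 / h * K ((x - s) / h)

/-- `f_{x,h}(t) = ∫₀¹ R(s,t) φ_{x,h}(s) ds`. -/
def fxh (R : ℝ → ℝ → ℝ) (K : ℝ → ℝ) (x h t : ℝ) : ℝ :=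
  ∫ s in (0 : ℝ)..1, R s t * phi K x h s

/-- The weights `m_{x,h}`: the row vector `(f_{x,h}(t_i))_i` times the inverse of the matrix
`(R(t_i,t_j))_{i,j}`. -/
def weights (R : ℝ → ℝ → ℝ) (K : ℝ → ℝ) {n : ℕ} (T : Fin n → ℝ) (x h : ℝ) : Fin n → ℝ :=
  Matrix.vecMul (fun i => fxh R K x h (T i)) (Matrix.of fun i j => R (T i) (T j))⁻¹

/-- The observation `Y_j(t) = g(t) + ε_j(t)`. -/
def obs {Ω : Type*} (g : ℝ → ℝ) (ε : ℕ → ℝ → Ω → ℝ) (j : ℕ) (t : ℝ) (ω : Ω) : ℝ :=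
  g t + ε j t ω

/-- The mean `Ȳ(t)` of the first `m` experimental units. -/
def meanObs {Ω : Type*} (g : ℝ → ℝ) (ε : ℕ → ℝ → Ω → ℝ) (m : ℕ) (t : ℝ) (ω : Ω) : ℝ :=
  1 / (m : ℝ) * ∑ j ∈ Finset.range m, obs g ε j t ω

/-- The projection estimator `∑ i, m_{x,h}(t_i) Ȳ(t_i)` of `g(x)`, for the design `T`, the
bandwidth `h` and `m` experimental units. -/
def estimator {Ω : Type*} (R : ℝ → ℝ → ℝ) (K g : ℝ → ℝ) (ε : ℕ → ℝ → Ω → ℝ)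
    {n : ℕ} (T : Fin n → ℝ) (m : ℕ) (h x : ℝ) (ω : Ω) : ℝ :=
  ∑ i, weights R K T x h i * meanObs g ε m (T i) ω

end ProjEst

end

noncomputable section

namespace ProjEst

open scoped RealInnerProductSpace

/-! ### Elementary interpolation estimates -/

section Interpolation

variable {q q' q'' : ℝ → ℝ} {a b B : ℝ}

/-! Everything is done in a Hilbert space with vectors `k t` whose Gram function is `R`; the error
ε(t) is the isometric image of `k t` under covariance. The projection weights W solve the normal
equations, so ∑ W_l k(τ_l) is the orthogonal projection of ∫ φ(s) k(s) ds onto the span of the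
kernel functions at the design points. The error of the estimator, times √m, is a bias, plus a
normalized sum of the prediction errors ∑ W_l ε_j(τ_l) - ε_j(x), plus (√m)⁻¹ ∑ ε_j(x). The last term
obeys the classical central limit theorem with variance R(x,x), so it suffices that the other two
vanish.

Both are handled by comparing W with the explicit coefficients obtained by integrating φ against
piecewise linear interpolants. Let a be the difference and p = ∑ a_l k(τ_l). The normal equations
turn ‖p‖² into the interpolation error of u ↦ ⟪p, k u⟫, integrated against φ. By (C) this function
has second derivative at most M‖p‖ inside each cell. Hence ‖p‖² = O(n⁻²)‖p‖ and ‖p‖ = O(n⁻²):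
`norm_nodeComb_sub_quadCoeff_le`.

Prediction error: its variance is ‖∑ W_l k(τ_l) - k x‖². The quadrature reproduces constants and φ
concentrates at x, so continuity of k at x makes this vanish (`exists_norm_nodeComb_sub_le`);
Chebyshev's inequality concludes.

Bias: the quadrature and smoothing errors are O(n⁻²) and O(h²). There remains ∑ a_l g(τ_l), for
which ‖p‖ must control ∑ |a_l|. By (B) the derivative of ⟪p, k u⟫ falls by a_l α(τ_l) at an inner
node τ_l, and second differences detect this jump. Testing p against a signed sum of second
differences, which has norm O(n), gives ∑ |a_l| = O(n)‖p‖ = O(1/n) (`exists_sum_abs_le`). The bias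
is therefore O(1/n + h²), and √m/n = √m h²/(n h²) tends to 0. -/

lemma abs_deriv_sub_le (hB : ∀ u ∈ Ioo a b, |q'' u| ≤ B)
    (h2 : ∀ u ∈ Ioo a b, HasDerivAt q' (q'' u) u) {u v : ℝ} (hu : u ∈ Ioo a b)
    (hv : v ∈ Ioo a b) : |q' u - q' v| ≤ B * (b - a) := by
  have h := (convex_Ioo a b).norm_image_sub_le_of_norm_hasDerivWithin_le
    (fun x hx => (h2 x hx).hasDerivWithinAt) (fun x hx => hB x hx) hv hu
  have hB0 : 0 ≤ B := (abs_nonneg _).trans (hB u hu)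
  have huv : |u - v| ≤ b - a := by
    rw [abs_le]; constructor <;> linarith [hu.1, hu.2, hv.1, hv.2]
  exact h.trans (mul_le_mul_of_nonneg_left huv hB0)

/-- The error of linear interpolation on `[a, b]` of a function with bounded second derivative. -/
lemma abs_sub_linear_interpolation_le (hab : a < b) (hc : ContinuousOn q (Icc a b))
    (h1 : ∀ u ∈ Ioo a b, HasDerivAt q (q' u) u)
    (h2 : ∀ u ∈ Ioo a b, HasDerivAt q' (q'' u) u) (hB : ∀ u ∈ Ioo a b, |q'' u| ≤ B)
    {s : ℝ} (hs : s ∈ Icc a b) :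
    |q s - ((b - s) / (b - a) * q a + (s - a) / (b - a) * q b)| ≤ B * (b - a) ^ 2 := by
  have hba : 0 < b - a := sub_pos.2 hab
  obtain ⟨ξ, hξ, hξe⟩ := exists_hasDerivAt_eq_slope q q' hab hc h1
  have hB0 : 0 ≤ B := (abs_nonneg _).trans (hB ξ hξ)
  rcases hs.1.eq_or_lt with rfl | has
  · have : q a - ((b - a) / (b - a) * q a + (a - a) / (b - a) * q b) = 0 := by
      field_simp; ring
    rw [this, abs_zero]; positivity
  obtain ⟨η, hη, hηe⟩ := exists_hasDerivAt_eq_slope q q' has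
    (hc.mono (Icc_subset_Icc le_rfl hs.2)) (fun u hu => h1 u ⟨hu.1, hu.2.trans_le hs.2⟩)
  have hsa : 0 < s - a := sub_pos.2 has
  have key : q s - ((b - s) / (b - a) * q a + (s - a) / (b - a) * q b)
      = (s - a) * (q' η - q' ξ) := by
    rw [hξe, hηe]; field_simp; ring
  rw [key, abs_mul, abs_of_pos hsa]
  have h := abs_deriv_sub_le hB h2 (u := η) (v := ξ) ⟨hη.1, hη.2.trans_le hs.2⟩ hξ
  calc (s - a) * |q' η - q' ξ| ≤ (b - a) * (B * (b - a)) :=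
        mul_le_mul (by linarith [hs.2]) h (abs_nonneg _) hba.le
    _ = B * (b - a) ^ 2 := by ring

/-- The slope is a value of q' inside the cell, and q' varies there by at most B(b - a). This lets
difference quotients stand in for one-sided derivatives at the nodes. -/
lemma abs_slope_sub_rightLim_le (hab : a < b) (hc : ContinuousOn q (Icc a b))
    (h1 : ∀ u ∈ Ioo a b, HasDerivAt q (q' u) u)
    (h2 : ∀ u ∈ Ioo a b, HasDerivAt q' (q'' u) u) (hB : ∀ u ∈ Ioo a b, |q'' u| ≤ B)
    {l : ℝ} (hl : Tendsto q' (𝓝[>] a) (𝓝 l)) :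
    |(q b - q a) / (b - a) - l| ≤ B * (b - a) := by
  obtain ⟨ξ, hξ, hξe⟩ := exists_hasDerivAt_eq_slope q q' hab hc h1
  rw [← hξe]
  refine le_of_tendsto ((tendsto_const_nhds.sub hl).abs) ?_
  filter_upwards [Ioo_mem_nhdsGT hab] with u hu using abs_deriv_sub_le hB h2 hξ hu

lemma abs_slope_sub_leftLim_le (hab : a < b) (hc : ContinuousOn q (Icc a b))
    (h1 : ∀ u ∈ Ioo a b, HasDerivAt q (q' u) u)
    (h2 : ∀ u ∈ Ioo a b, HasDerivAt q' (q'' u) u) (hB : ∀ u ∈ Ioo a b, |q'' u| ≤ B)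
    {l : ℝ} (hl : Tendsto q' (𝓝[<] b) (𝓝 l)) :
    |(q b - q a) / (b - a) - l| ≤ B * (b - a) := by
  obtain ⟨ξ, hξ, hξe⟩ := exists_hasDerivAt_eq_slope q q' hab hc h1
  rw [← hξe]
  refine le_of_tendsto ((tendsto_const_nhds.sub hl).abs) ?_
  filter_upwards [Ioo_mem_nhdsLT hab] with u hu using abs_deriv_sub_le hB h2 hξ hu

end Interpolation

/-! ### Regularity of the autocovariance function off the diagonal -/

section Regularity

variable {R : ℝ → ℝ → ℝ}

lemma AssumptionA.continuousOn_right (hA : AssumptionA R) {s : ℝ} (hs : s ∈ Icc (0 : ℝ) 1) :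
    ContinuousOn (R s) (Icc 0 1) :=
  hA.continuousOn.comp (f := fun u => (s, u)) (by fun_prop) fun _ hu => ⟨hs, hu⟩

lemma contDiffOn_derivWithin_Icc {q : ℝ → ℝ} {U : Set ℝ} {a b : ℝ} {m n : WithTop ℕ∞}
    (hU : IsOpen U) (hUI : U ⊆ Ioo a b) (hq : ContDiffOn ℝ n q U) (hmn : m + 1 ≤ n) :
    ContDiffOn ℝ m (derivWithin q (Icc a b)) U :=
  (hq.deriv_of_isOpen hU hmn).congr fun _ hu =>
    derivWithin_of_mem_nhds (Icc_mem_nhds (hUI hu).1 (hUI hu).2)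

lemma hasDerivAt_derivWithin_Icc {q : ℝ → ℝ} {U : Set ℝ} {a b : ℝ}
    (hU : IsOpen U) (hUI : U ⊆ Ioo a b) (hq : ContDiffOn ℝ 1 q U) {u : ℝ} (hu : u ∈ U) :
    HasDerivAt q (derivWithin q (Icc a b) u) u := by
  rw [derivWithin_of_mem_nhds (Icc_mem_nhds (hUI hu).1 (hUI hu).2)]
  exact ((hq.contDiffAt (hU.mem_nhds hu)).differentiableAt one_ne_zero).hasDerivAt

/-- The last conjunct is the link with (C): away from the diagonal the right limit occurring there
is the ordinary second derivative. -/
lemma AssumptionA.hasDerivAt (hA : AssumptionA R) {s u : ℝ} (hs : s ∈ Icc (0 : ℝ) 1)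
    (hu : u ∈ Ioo (0 : ℝ) 1) (hsu : s ≠ u) :
    HasDerivAt (R s) (d01 R s u) u ∧ HasDerivAt (d01 R s) (d02 R s u) u ∧
      d02Right R s u = d02 R s u := by
  set U : Set ℝ := Ioo 0 1 ∩ {s}ᶜ
  have hU : IsOpen U := isOpen_Ioo.inter isOpen_compl_singleton
  have hUI : U ⊆ Ioo 0 1 := inter_subset_left
  have huU : u ∈ U := ⟨hu, fun h => hsu h.symm⟩
  have h0 : ContDiffOn ℝ 2 (R s) U :=
    hA.offDiag.comp (f := fun u => (s, u)) (by fun_prop)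
      fun v hv => ⟨hs, Ioo_subset_Icc_self hv.1, fun h => hv.2 h.symm⟩
  have h1 : ContDiffOn ℝ 1 (d01 R s) U :=
    contDiffOn_derivWithin_Icc hU hUI h0 (by norm_num)
  have h2 : ContDiffOn ℝ 0 (d02 R s) U :=
    contDiffOn_derivWithin_Icc hU hUI h1 (by norm_num)
  refine ⟨hasDerivAt_derivWithin_Icc hU hUI (h0.of_le (by norm_num)) huU,
    hasDerivAt_derivWithin_Icc hU hUI h1 huU, rightLim_eq_of_tendsto ?_⟩
  exact (h2.continuousOn.continuousAt (hU.mem_nhds huU)).tendsto.mono_left nhdsWithin_le_nhds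

lemma AssumptionA.tendsto_left (hA : AssumptionA R) {t : ℝ} (ht : t ∈ Ioo (0 : ℝ) 1) :
    Tendsto (d01 R t) (𝓝[<] t) (𝓝 (d01Left R t t)) := by
  obtain ⟨l, hl⟩ := hA.left1 t ⟨ht.1, ht.2.le⟩
  rwa [d01Left, leftLim_eq_of_tendsto hl]

lemma AssumptionA.tendsto_right (hA : AssumptionA R) {t : ℝ} (ht : t ∈ Ioo (0 : ℝ) 1) :
    Tendsto (d01 R t) (𝓝[>] t) (𝓝 (d01Right R t t)) := by
  obtain ⟨l, hl⟩ := hA.right1 t ⟨ht.1.le, ht.2⟩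
  rwa [d01Right, rightLim_eq_of_tendsto hl]

end Regularity

/-! ### Kernel functions -/

variable {H : Type*} [NormedAddCommGroup H] [InnerProductSpace ℝ H]

/-- A family `k` of vectors with Gram function `R` on `[0,1]`, such that integration against
suitable vectors of norm at most `M` gives the second derivatives `R^{(0,2)}(·,u⁺)`. -/
structure IsKernelFamily (R : ℝ → ℝ → ℝ) (k : ℝ → H) (M : ℝ) : Prop where
  inner_eq : ∀ s ∈ Icc (0 : ℝ) 1, ∀ t ∈ Icc (0 : ℝ) 1, ⟪k s, k t⟫ = R s t
  exists_d02 : ∀ u ∈ Ioo (0 : ℝ) 1, ∃ ρ : H,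
    (∀ s ∈ Icc (0 : ℝ) 1, ⟪k s, ρ⟫ = d02Right R s u) ∧ ‖ρ‖ ≤ M

/-- The kernel functions are extended by 0 outside [0,1], so that later arguments index them by real
numbers instead of a subtype. -/
lemma AssumptionC.exists_isKernelFamily {R : ℝ → ℝ → ℝ} (hC : AssumptionC R) :
    ∃ (H : Type) (_ : NormedAddCommGroup H) (_ : InnerProductSpace ℝ H) (k : ℝ → H) (M : ℝ),
      IsKernelFamily R k M := by
  obtain ⟨H, i1, i2, i3, i4, hker, M, hM⟩ := hC
  refine ⟨H, i1, i2, fun s => if hs : s ∈ Icc (0 : ℝ) 1 then RKHS.kerFun H ⟨s, hs⟩ 1 else 0, M,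
    ?_, ?_⟩
  · intro s hs t ht
    have h := hker ⟨s, hs⟩ ⟨t, ht⟩
    simp only [hs, ht, dif_pos]
    rw [RKHS.kerFun_inner, RKHS.kerFun_apply, h]
    simp
  · intro u hu
    obtain ⟨ρ, h1, h2⟩ := hM u ⟨hu.1.le, hu.2⟩
    refine ⟨ρ, fun s hs => ?_, h2⟩
    simp only [hs, dif_pos]
    rw [RKHS.kerFun_inner, h1 ⟨s, hs⟩]
    simp

namespace IsKernelFamily

variable {R : ℝ → ℝ → ℝ} {k : ℝ → H} {M : ℝ}

lemma bound_nonneg (hk : IsKernelFamily R k M) : 0 ≤ M := by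
  obtain ⟨ρ, -, h⟩ := hk.exists_d02 (1 / 2) (by norm_num)
  exact (norm_nonneg _).trans h

lemma symm (hk : IsKernelFamily R k M) {s t : ℝ} (hs : s ∈ Icc (0 : ℝ) 1)
    (ht : t ∈ Icc (0 : ℝ) 1) : R s t = R t s := by
  rw [← hk.inner_eq s hs t ht, ← hk.inner_eq t ht s hs, real_inner_comm]

lemma exists_norm_le (hk : IsKernelFamily R k M) (hA : AssumptionA R) :
    ∃ C, ∀ t ∈ Icc (0 : ℝ) 1, ‖k t‖ ≤ C := by
  have hc : ContinuousOn (fun t => R t t) (Icc 0 1) :=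
    hA.continuousOn.comp (f := fun t => (t, t)) (by fun_prop) fun _ hu => ⟨hu, hu⟩
  obtain ⟨C, hC⟩ := isCompact_Icc.exists_bound_of_continuousOn hc
  refine ⟨√C, fun t ht => Real.le_sqrt_of_sq_le ?_⟩
  rw [← real_inner_self_eq_norm_sq, hk.inner_eq t ht t ht]
  exact (le_abs_self _).trans (hC t ht)

/-- The squared distance is R(s,s) - 2 R(s,x) + R(x,x), so continuity of `R` at (x,x) is enough. -/
lemma tendsto_norm_sub (hk : IsKernelFamily R k M) (hA : AssumptionA R) {x : ℝ}
    (hx : x ∈ Ioo (0 : ℝ) 1) : Tendsto (fun s => ‖k s - k x‖) (𝓝 x) (𝓝 0) := by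
  have hxI := Ioo_subset_Icc_self hx
  have hmem : Icc (0 : ℝ) 1 ∈ 𝓝 x := Icc_mem_nhds hx.1 hx.2
  have hcont : ContinuousAt (fun p : ℝ × ℝ => R p.1 p.2) (x, x) :=
    hA.continuousOn.continuousAt (prod_mem_nhds hmem hmem)
  have h1 : Tendsto (fun s => R s s) (𝓝 x) (𝓝 (R x x)) :=
    hcont.tendsto.comp (f := fun s => (s, s)) ((continuous_id.prodMk continuous_id).tendsto x)
  have h2 : Tendsto (fun s => R s x) (𝓝 x) (𝓝 (R x x)) :=
    hcont.tendsto.comp (f := fun s => (s, x)) ((continuous_id.prodMk continuous_const).tendsto x)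
  have h3 : Tendsto (fun s => √(R s s - 2 * R s x + R x x)) (𝓝 x) (𝓝 0) := by
    have := ((h1.sub (h2.const_mul 2)).add_const (R x x)).sqrt
    simpa [show R x x - 2 * R x x + R x x = 0 by ring] using this
  refine h3.congr' ?_
  filter_upwards [hmem] with s hs
  rw [← hk.inner_eq s hs s hs, ← hk.inner_eq s hs x hxI, ← hk.inner_eq x hxI x hxI,
    real_inner_self_eq_norm_sq, real_inner_self_eq_norm_sq, ← norm_sub_sq_real,
    Real.sqrt_sq (norm_nonneg _)]

end IsKernelFamily

open scoped RealInnerProductSpace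

/-! ### Meshes of `[0,1]` -/

/-- `0 = τ 0 < τ 1 < ⋯ < τ n = 1` with all gaps between `c / n` and `C / n`. -/
structure IsMesh (τ : ℕ → ℝ) (n : ℕ) (c C : ℝ) : Prop where
  pos : 0 < n
  const_pos : 0 < c
  zero : τ 0 = 0
  last : τ n = 1
  lower : ∀ i < n, c / n ≤ τ (i + 1) - τ i
  upper : ∀ i < n, τ (i + 1) - τ i ≤ C / n

namespace IsMesh

variable {τ : ℕ → ℝ} {n : ℕ} {c C : ℝ}

lemma cast_pos (hτ : IsMesh τ n c C) : (0 : ℝ) < n := by exact_mod_cast hτ.pos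

lemma gap_pos (hτ : IsMesh τ n c C) {i : ℕ} (hi : i < n) : 0 < τ (i + 1) - τ i :=
  (div_pos hτ.const_pos hτ.cast_pos).trans_le (hτ.lower i hi)

lemma upper_pos (hτ : IsMesh τ n c C) : 0 < C := by
  have h := (hτ.gap_pos hτ.pos).trans_le (hτ.upper 0 hτ.pos)
  exact (div_pos_iff_of_pos_right hτ.cast_pos).1 h

lemma le_of_le (hτ : IsMesh τ n c C) {i j : ℕ} (hij : i ≤ j) (hj : j ≤ n) : τ i ≤ τ j := by
  induction j, hij using Nat.le_induction with
  | base => exact le_rfl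
  | succ j _ ih => linarith [ih (by omega), hτ.gap_pos (i := j) (by omega)]

lemma lt_of_lt (hτ : IsMesh τ n c C) {i j : ℕ} (hij : i < j) (hj : j ≤ n) : τ i < τ j := by
  have h1 := hτ.gap_pos (i := i) (by omega)
  have h2 := hτ.le_of_le (i := i + 1) (j := j) hij hj
  linarith

lemma mem_Icc (hτ : IsMesh τ n c C) {l : ℕ} (hl : l ≤ n) : τ l ∈ Icc (0 : ℝ) 1 :=
  ⟨hτ.zero ▸ hτ.le_of_le (Nat.zero_le l) hl, hτ.last ▸ hτ.le_of_le hl le_rfl⟩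

lemma mem_Ioo (hτ : IsMesh τ n c C) {l : ℕ} (h0 : 0 < l) (hl : l < n) : τ l ∈ Ioo (0 : ℝ) 1 :=
  ⟨hτ.zero ▸ hτ.lt_of_lt h0 hl.le, hτ.last ▸ hτ.lt_of_lt hl le_rfl⟩

lemma Icc_subset (hτ : IsMesh τ n c C) {i : ℕ} (hi : i < n) :
    Icc (τ i) (τ (i + 1)) ⊆ Icc 0 1 :=
  Icc_subset_Icc (hτ.mem_Icc hi.le).1 (hτ.mem_Icc hi).2

lemma Ioo_subset (hτ : IsMesh τ n c C) {i : ℕ} (hi : i < n) :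
    Ioo (τ i) (τ (i + 1)) ⊆ Ioo 0 1 :=
  Ioo_subset_Ioo (hτ.mem_Icc hi.le).1 (hτ.mem_Icc hi).2

lemma ne_of_mem_Ioo (hτ : IsMesh τ n c C) {i l : ℕ} (hi : i < n) (hl : l ≤ n) {u : ℝ}
    (hu : u ∈ Ioo (τ i) (τ (i + 1))) : τ l ≠ u := by
  rcases Nat.lt_or_ge i l with h | h
  · exact (hu.2.trans_le (hτ.le_of_le h hl)).ne'
  · exact ((hτ.le_of_le h hi.le).trans_lt hu.1).ne

lemma ne_of_ne (hτ : IsMesh τ n c C) {i l : ℕ} (hi : i ≤ n) (hl : l ≤ n) (hil : i ≠ l) :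
    τ i ≠ τ l := by
  rcases Nat.lt_or_gt_of_ne hil with h | h
  · exact (hτ.lt_of_lt h hl).ne
  · exact (hτ.lt_of_lt h hi).ne'

lemma inv_gap_le (hτ : IsMesh τ n c C) {i : ℕ} (hi : i < n) : (τ (i + 1) - τ i)⁻¹ ≤ n / c := by
  rw [← inv_div]
  exact inv_anti₀ (div_pos hτ.const_pos hτ.cast_pos) (hτ.lower i hi)

end IsMesh

/-! ### Linear combinations of kernel functions at the nodes -/

/-- R(s,·) has a kink only at its own base point; at every other inner t the two one-sided
derivatives agree. -/
lemma AssumptionA.d01_limits {R : ℝ → ℝ → ℝ} (hA : AssumptionA R) {s t : ℝ}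
    (hs : s ∈ Icc (0 : ℝ) 1) (ht : t ∈ Ioo (0 : ℝ) 1) :
    Tendsto (d01 R s) (𝓝[<] t) (𝓝 (d01Left R s t)) ∧
      Tendsto (d01 R s) (𝓝[>] t) (𝓝 (d01Right R s t)) ∧
      (s ≠ t → d01Left R s t = d01Right R s t) := by
  rcases eq_or_ne s t with rfl | hst
  · exact ⟨hA.tendsto_left ht, hA.tendsto_right ht, fun h => (h rfl).elim⟩
  · have hc := (hA.hasDerivAt hs ht hst).2.1.continuousAt.tendsto
    have h1 : d01Left R s t = d01 R s t :=
      leftLim_eq_of_tendsto (hc.mono_left nhdsWithin_le_nhds)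
    have h2 : d01Right R s t = d01 R s t :=
      rightLim_eq_of_tendsto (hc.mono_left nhdsWithin_le_nhds)
    rw [h1, h2]
    exact ⟨hc.mono_left nhdsWithin_le_nhds, hc.mono_left nhdsWithin_le_nhds, fun _ => rfl⟩

/-- The linear combination `∑ a_l k(τ_l)`. -/
def nodeComb (k : ℝ → H) (τ : ℕ → ℝ) (n : ℕ) (a : ℕ → ℝ) : H :=
  ∑ l ∈ Finset.range (n + 1), a l • k (τ l)

/-- The slope of `k` over the `i`-th cell of the mesh. -/
def nodeSlope (k : ℝ → H) (τ : ℕ → ℝ) (i : ℕ) : H :=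
  (τ (i + 1) - τ i)⁻¹ • (k (τ (i + 1)) - k (τ i))

/-- The second difference of `k` at the node `τ (i + 1)`. -/
def nodeDiff (k : ℝ → H) (τ : ℕ → ℝ) (i : ℕ) : H :=
  nodeSlope k τ (i + 1) - nodeSlope k τ i

section

variable {R : ℝ → ℝ → ℝ} {k : ℝ → H} {M : ℝ} {τ : ℕ → ℝ} {n : ℕ} {c C : ℝ}

lemma inner_nodeComb (hk : IsKernelFamily R k M) (hτ : IsMesh τ n c C) (a : ℕ → ℝ) {s : ℝ}
    (hs : s ∈ Icc (0 : ℝ) 1) :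
    ⟪nodeComb k τ n a, k s⟫ = ∑ l ∈ Finset.range (n + 1), a l * R (τ l) s := by
  rw [nodeComb, sum_inner]
  refine Finset.sum_congr rfl fun l hl => ?_
  rw [real_inner_smul_left, hk.inner_eq _ (hτ.mem_Icc (by simpa [Nat.lt_succ_iff] using hl)) _ hs]

/-- No node lies inside a cell, so each summand is twice differentiable there. The second derivative
of the combination is its inner product with the vector ρ of (C). Cauchy–Schwarz then bounds it by
the norm of the combination, whatever the size of the coefficients. -/
lemma nodeComb_cell (hk : IsKernelFamily R k M) (hA : AssumptionA R) (hτ : IsMesh τ n c C)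
    (a : ℕ → ℝ) {i : ℕ} (hi : i < n) :
    ContinuousOn (fun u => ⟪nodeComb k τ n a, k u⟫) (Icc (τ i) (τ (i + 1))) ∧
    (∀ u ∈ Ioo (τ i) (τ (i + 1)), HasDerivAt (fun u => ⟪nodeComb k τ n a, k u⟫)
      (∑ l ∈ Finset.range (n + 1), a l * d01 R (τ l) u) u) ∧
    (∀ u ∈ Ioo (τ i) (τ (i + 1)),
      HasDerivAt (fun u => ∑ l ∈ Finset.range (n + 1), a l * d01 R (τ l) u)
        (∑ l ∈ Finset.range (n + 1), a l * d02 R (τ l) u) u) ∧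
    (∀ u ∈ Ioo (τ i) (τ (i + 1)),
      |∑ l ∈ Finset.range (n + 1), a l * d02 R (τ l) u| ≤ M * ‖nodeComb k τ n a‖) := by
  have hmem : ∀ l ∈ Finset.range (n + 1), l ≤ n := fun l hl => by
    simpa [Nat.lt_succ_iff] using hl
  have hder : ∀ u ∈ Ioo (τ i) (τ (i + 1)), ∀ l ∈ Finset.range (n + 1), _ :=
    fun u hu l hl => hA.hasDerivAt (hτ.mem_Icc (hmem l hl)) (hτ.Ioo_subset hi hu)
      (hτ.ne_of_mem_Ioo hi (hmem l hl) hu)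
  refine ⟨?_, fun u hu => ?_, fun u hu => ?_, fun u hu => ?_⟩
  · refine ContinuousOn.congr (f := fun u => ∑ l ∈ Finset.range (n + 1), a l * R (τ l) u) ?_
      fun u hu => inner_nodeComb hk hτ a (hτ.Icc_subset hi hu)
    exact continuousOn_finsetSum _ fun l hl => continuousOn_const.mul
      ((hA.continuousOn_right (hτ.mem_Icc (hmem l hl))).mono (hτ.Icc_subset hi))
  · refine HasDerivAt.congr_of_eventuallyEq
      (f := fun u => ∑ l ∈ Finset.range (n + 1), a l * R (τ l) u) ?_ ?_
    · exact HasDerivAt.fun_sum fun l hl => (hder u hu l hl).1.const_mul (a l)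
    · filter_upwards [Ioo_mem_nhds hu.1 hu.2] with v hv
      exact inner_nodeComb hk hτ a (hτ.Icc_subset hi (Ioo_subset_Icc_self hv))
  · exact HasDerivAt.fun_sum fun l hl => (hder u hu l hl).2.1.const_mul (a l)
  · obtain ⟨ρ, hρ, hρM⟩ := hk.exists_d02 u (hτ.Ioo_subset hi hu)
    have : ∑ l ∈ Finset.range (n + 1), a l * d02 R (τ l) u = ⟪nodeComb k τ n a, ρ⟫ := by
      rw [nodeComb, sum_inner]
      refine Finset.sum_congr rfl fun l hl => ?_
      rw [real_inner_smul_left, hρ _ (hτ.mem_Icc (hmem l hl)), (hder u hu l hl).2.2]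
    rw [this, mul_comm]
    exact (abs_real_inner_le_norm _ _).trans (mul_le_mul_of_nonneg_left hρM (norm_nonneg _))

lemma nodeComb_interpolation (hk : IsKernelFamily R k M) (hA : AssumptionA R)
    (hτ : IsMesh τ n c C) (a : ℕ → ℝ) {i : ℕ} (hi : i < n) {s : ℝ}
    (hs : s ∈ Icc (τ i) (τ (i + 1))) :
    |⟪nodeComb k τ n a, k s⟫ -
      ((τ (i + 1) - s) / (τ (i + 1) - τ i) * ⟪nodeComb k τ n a, k (τ i)⟫ +
        (s - τ i) / (τ (i + 1) - τ i) * ⟪nodeComb k τ n a, k (τ (i + 1))⟫)|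
      ≤ M * ‖nodeComb k τ n a‖ * (C / n) ^ 2 := by
  obtain ⟨h0, h1, h2, h3⟩ := nodeComb_cell hk hA hτ a hi
  refine (abs_sub_linear_interpolation_le (sub_pos.1 (hτ.gap_pos hi)) h0 h1 h2 h3 hs).trans ?_
  have := hk.bound_nonneg
  have := hτ.gap_pos hi
  have := hτ.upper i hi
  gcongr

/-- The two slopes approximate the right and left derivatives at the node, each within M‖p‖C/n for p
the combination. Their difference is minus the jump, to which only the summand based at that node
contributes. -/
lemma inner_nodeComb_nodeDiff (hk : IsKernelFamily R k M) (hA : AssumptionA R)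
    (hτ : IsMesh τ n c C) (a : ℕ → ℝ) {j : ℕ} (hj : j + 1 < n) :
    |⟪nodeComb k τ n a, nodeDiff k τ j⟫ + a (j + 1) * jump R (τ (j + 1))|
      ≤ 2 * M * C / n * ‖nodeComb k τ n a‖ := by
  have hj' : j < n := by omega
  obtain ⟨h0, h1, h2, h3⟩ := nodeComb_cell hk hA hτ a hj
  obtain ⟨g0, g1, g2, g3⟩ := nodeComb_cell hk hA hτ a hj'
  have ht := hτ.mem_Ioo (Nat.succ_pos j) hj
  have hlim : ∀ l ∈ Finset.range (n + 1), _ := fun l hl => hA.d01_limits (s := τ l)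
    (hτ.mem_Icc (by simpa [Nat.lt_succ_iff] using hl)) ht
  have e1 := abs_slope_sub_rightLim_le (sub_pos.1 (hτ.gap_pos hj)) h0 h1 h2 h3
    (tendsto_finsetSum _ fun l hl => (hlim l hl).2.1.const_mul (a l))
  have e2 := abs_slope_sub_leftLim_le (sub_pos.1 (hτ.gap_pos hj')) g0 g1 g2 g3
    (tendsto_finsetSum _ fun l hl => (hlim l hl).1.const_mul (a l))
  have hjump : ∑ l ∈ Finset.range (n + 1), a l * d01Left R (τ l) (τ (j + 1)) -
      ∑ l ∈ Finset.range (n + 1), a l * d01Right R (τ l) (τ (j + 1))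
      = a (j + 1) * jump R (τ (j + 1)) := by
    rw [← Finset.sum_sub_distrib, Finset.sum_eq_single (j + 1)]
    · rw [jump]; ring
    · intro l hl hne
      rw [(hlim l hl).2.2 (hτ.ne_of_ne (by simpa [Nat.lt_succ_iff] using hl) hj.le hne), sub_self]
    · intro h; exact (h (by simp; omega)).elim
  have hB : 0 ≤ M * ‖nodeComb k τ n a‖ := mul_nonneg hk.bound_nonneg (norm_nonneg _)
  have e1' := e1.trans (mul_le_mul_of_nonneg_left (hτ.upper _ hj) hB)
  have e2' := e2.trans (mul_le_mul_of_nonneg_left (hτ.upper _ hj') hB)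
  have hD : ⟪nodeComb k τ n a, nodeDiff k τ j⟫ =
      (⟪nodeComb k τ n a, k (τ (j + 1 + 1))⟫ - ⟪nodeComb k τ n a, k (τ (j + 1))⟫)
        / (τ (j + 1 + 1) - τ (j + 1)) -
      (⟪nodeComb k τ n a, k (τ (j + 1))⟫ - ⟪nodeComb k τ n a, k (τ j)⟫)
        / (τ (j + 1) - τ j) := by
    simp only [nodeDiff, nodeSlope, inner_sub_right, real_inner_smul_right]
    ring
  rw [hD, ← hjump]
  rw [abs_le] at e1' e2' ⊢
  have : 2 * M * C / n * ‖nodeComb k τ n a‖ = 2 * (M * ‖nodeComb k τ n a‖ * (C / n)) := by ring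
  rw [this]
  constructor <;> linarith [e1'.1, e1'.2, e2'.1, e2'.2]

lemma nodeComb_single (k : ℝ → H) (τ : ℕ → ℝ) {l : ℕ} (hl : l ≤ n) :
    nodeComb k τ n (Pi.single l 1) = k (τ l) := by
  rw [nodeComb, Finset.sum_eq_single l]
  · simp
  · intro j _ hj; simp [Pi.single_eq_of_ne hj]
  · intro h; exact (h (by simp; omega)).elim

/-- A signed sum of second differences of kernel functions has norm `O(n)`. -/
lemma norm_sum_nodeDiff_le (hk : IsKernelFamily R k M) (hA : AssumptionA R)
    (hτ : IsMesh τ (n + 1) c C) {A B : ℝ} (hAj : ∀ t ∈ Ioo (0 : ℝ) 1, |jump R t| ≤ A)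
    (hB : ∀ t ∈ Icc (0 : ℝ) 1, ‖k t‖ ≤ B) {σ : ℕ → ℝ} (hσ : ∀ j, |σ j| ≤ 1) :
    ‖∑ j ∈ Finset.range n, σ j • nodeDiff k τ j‖ ≤
      √(4 * (A + 2 * M * C * B) / c) * (n + 1 : ℕ) := by
  set q := ∑ j ∈ Finset.range n, σ j • nodeDiff k τ j with hq
  set D := A + 2 * M * C * B with hD
  have hN := hτ.cast_pos
  have hM := hk.bound_nonneg
  have hC := hτ.upper_pos
  have hB0 : 0 ≤ B := (norm_nonneg _).trans (hB 0 (by simp))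
  have hA0 : 0 ≤ A := (abs_nonneg _).trans (hAj (1 / 2) (by norm_num))
  -- A single kernel function is a combination with a unit coefficient vector. At most one second
  -- difference sees its kink; the others contribute O(1/n) each, so the total stays bounded.
  have hkq : ∀ l ≤ n + 1, |⟪k (τ l), q⟫| ≤ D := by
    intro l hl
    have hterm : ∀ j ∈ Finset.range n, |⟪k (τ l), σ j • nodeDiff k τ j⟫| ≤
        (if l = j + 1 then A else 0) + 2 * M * C * B / (n + 1 : ℕ) := by
      intro j hj
      have hj1 : j + 1 < n + 1 := by simpa using hj
      have h := inner_nodeComb_nodeDiff hk hA hτ (Pi.single l 1) hj1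
      rw [nodeComb_single k τ hl] at h
      have h1 : 2 * M * C / (n + 1 : ℕ) * ‖k (τ l)‖ ≤ 2 * M * C * B / (n + 1 : ℕ) := by
        rw [div_mul_eq_mul_div]
        gcongr
        exact hB _ (hτ.mem_Icc hl)
      have h2 : |(Pi.single l 1 : ℕ → ℝ) (j + 1) * jump R (τ (j + 1))| ≤
          if l = j + 1 then A else 0 := by
        split_ifs with hlj
        · subst hlj
          simpa using hAj _ (hτ.mem_Ioo (Nat.succ_pos j) hj1)
        · simp [Pi.single_eq_of_ne (Ne.symm hlj)]
      rw [real_inner_smul_right, abs_mul]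
      calc |σ j| * |⟪k (τ l), nodeDiff k τ j⟫| ≤ 1 * |⟪k (τ l), nodeDiff k τ j⟫| :=
            mul_le_mul_of_nonneg_right (hσ j) (abs_nonneg _)
        _ ≤ _ := by
            rw [one_mul]
            rw [abs_le] at h h2 ⊢
            constructor <;> linarith [h.1, h.2, h2.1, h2.2]
    rw [hq, inner_sum]
    refine (Finset.abs_sum_le_sum_abs _ _).trans ((Finset.sum_le_sum hterm).trans ?_)
    rw [Finset.sum_add_distrib, Finset.sum_const, Finset.card_range, nsmul_eq_mul, hD]
    refine add_le_add ?_ ?_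
    · rcases l with _ | l
      · simpa using hA0
      · simp only [Nat.add_right_cancel_iff, Finset.sum_ite_eq]
        split_ifs <;> simp [hA0]
    · rw [mul_div_assoc', div_le_iff₀ hN, mul_comm]
      have : (0 : ℝ) ≤ 2 * M * C * B := by positivity
      gcongr
      simp
  -- Dividing a bounded difference by a gap of at least c/n costs a factor n/c.
  have hslope : ∀ i < n + 1, |⟪nodeSlope k τ i, q⟫| ≤ (n + 1 : ℕ) / c * (2 * D) := by
    intro i hi
    rw [nodeSlope, real_inner_smul_left, inner_sub_left, abs_mul,
      abs_of_pos (inv_pos.2 (hτ.gap_pos hi))]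
    refine mul_le_mul (hτ.inv_gap_le hi) ?_ (abs_nonneg _) ?_
    · exact (abs_sub _ _).trans (by linarith [hkq i hi.le, hkq (i + 1) hi])
    · have := hτ.const_pos; positivity
  -- Expanding one copy of q in ‖q‖² leaves n pairings of second differences with q, each O(n);
  -- hence ‖q‖ = O(n).
  have hqq : ‖q‖ ^ 2 ≤ (4 * D / c) * ((n + 1 : ℕ) : ℝ) ^ 2 := by
    have hterm : ∀ j ∈ Finset.range n, ⟪σ j • nodeDiff k τ j, q⟫ ≤ (n + 1 : ℕ) / c * (4 * D) := by
      intro j hj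
      have hj1 : j < n := by simpa using hj
      rw [real_inner_smul_left]
      refine (le_abs_self _).trans ?_
      rw [abs_mul]
      refine (mul_le_mul_of_nonneg_right (hσ j) (abs_nonneg _)).trans ?_
      rw [one_mul, nodeDiff, inner_sub_left]
      refine (abs_sub _ _).trans ?_
      linarith [hslope j (by omega), hslope (j + 1) (by omega)]
    have hD0 : 0 ≤ D := (abs_nonneg _).trans (hkq 0 (by omega))
    have hc := hτ.const_pos
    calc ‖q‖ ^ 2 = ∑ j ∈ Finset.range n, ⟪σ j • nodeDiff k τ j, q⟫ := by
          rw [← real_inner_self_eq_norm_sq, ← sum_inner]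
      _ ≤ n • ((n + 1 : ℕ) / c * (4 * D)) := by
          simpa using Finset.sum_le_sum hterm
      _ ≤ (n + 1 : ℕ) * ((n + 1 : ℕ) / c * (4 * D)) := by
          rw [nsmul_eq_mul]
          gcongr
          simp
      _ = _ := by ring
  calc ‖q‖ ≤ √((4 * D / c) * ((n + 1 : ℕ) : ℝ) ^ 2) := Real.le_sqrt_of_sq_le hqq
    _ = _ := by rw [Real.sqrt_mul' _ (sq_nonneg _), Real.sqrt_sq hN.le]

/-- The coefficients of a combination of kernel functions at the nodes `τ 1, …, τ n` are
controlled by its norm. -/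
lemma exists_sum_abs_le (hk : IsKernelFamily R k M) (hA : AssumptionA R) (hB : AssumptionB R)
    (hR1 : R 1 1 ≠ 0) (c C : ℝ) :
    ∃ K : ℝ, ∀ (τ : ℕ → ℝ) (n : ℕ), IsMesh τ n c C → ∀ a : ℕ → ℝ, a 0 = 0 →
      ∑ l ∈ Finset.range (n + 1), |a l| ≤ K * n * ‖nodeComb k τ n a‖ := by
  obtain ⟨B, hkB⟩ := hk.exists_norm_le hA
  obtain ⟨α₀, hα₀, hα⟩ := hB.inf_pos
  obtain ⟨A, hAub⟩ := hB.bddAbove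
  have hAj : ∀ t ∈ Ioo (0 : ℝ) 1, |jump R t| ≤ A := fun t ht => by
    rw [abs_of_pos (hα₀.trans_le (hα t ht))]
    exact hAub (mem_image_of_mem _ ht)
  -- The constant for the inner nodes: the square root is the norm bound for the signed sum of
  -- second differences, 2MC collects the remainders, and α₀ bounds the jumps from below.
  set K₁ := (√(4 * (A + 2 * M * C * B) / c) + 2 * M * C) / α₀ with hK₁
  have h1 : (1 : ℝ) ∈ Icc (0 : ℝ) 1 := by simp
  have hB0 : 0 ≤ B := (norm_nonneg _).trans (hkB 1 h1)
  refine ⟨K₁ + (B + B * B * K₁) / |R 1 1|, fun τ N hτ a ha0 => ?_⟩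
  obtain ⟨n, rfl⟩ : ∃ n, N = n + 1 := ⟨N - 1, by have := hτ.pos; omega⟩
  set p := nodeComb k τ (n + 1) a with hp
  have hN := hτ.cast_pos
  have hM := hk.bound_nonneg
  have hC := hτ.upper_pos
  have hN1 : (1 : ℝ) ≤ (n + 1 : ℕ) := by simp
  have hinner : ∑ j ∈ Finset.range n, |a (j + 1)| ≤ K₁ * (n + 1 : ℕ) * ‖p‖ := by
    -- With these signs the jump terms add up to at least α₀ ∑ |a_j|.
    set σ : ℕ → ℝ := fun j => (SignType.sign (a (j + 1)) : ℝ) with hσ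
    have hσ1 : ∀ j, |σ j| ≤ 1 := fun j => by
      rcases lt_trichotomy (a (j + 1)) 0 with h | h | h <;> simp [hσ, h]
    have hqn := norm_sum_nodeDiff_le hk hA hτ hAj hkB hσ1
    have hterm : ∀ j ∈ Finset.range n, α₀ * |a (j + 1)| ≤
        -⟪p, σ j • nodeDiff k τ j⟫ + 2 * M * C / (n + 1 : ℕ) * ‖p‖ := by
      intro j hj
      have hj1 : j + 1 < n + 1 := by simpa using hj
      have h := inner_nodeComb_nodeDiff hk hA hτ a hj1
      have hα' := hα _ (hτ.mem_Ioo (Nat.succ_pos j) hj1)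
      have hsgn : σ j * a (j + 1) = |a (j + 1)| := sign_mul_self _
      have e : σ j * (⟪p, nodeDiff k τ j⟫ + a (j + 1) * jump R (τ (j + 1)))
          ≤ 2 * M * C / (n + 1 : ℕ) * ‖p‖ := by
        refine (le_abs_self _).trans ?_
        rw [abs_mul]
        refine (mul_le_mul_of_nonneg_right (hσ1 j) (abs_nonneg _)).trans ?_
        rwa [one_mul]
      rw [real_inner_smul_right]
      have e2 : α₀ * |a (j + 1)| ≤ jump R (τ (j + 1)) * |a (j + 1)| :=
        mul_le_mul_of_nonneg_right hα' (abs_nonneg _)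
      rw [← hsgn] at e2 ⊢
      linarith
    have hsum := Finset.sum_le_sum hterm
    rw [← Finset.mul_sum, Finset.sum_add_distrib, Finset.sum_neg_distrib, ← inner_sum,
      Finset.sum_const, Finset.card_range, nsmul_eq_mul] at hsum
    have e1 : -⟪p, ∑ j ∈ Finset.range n, σ j • nodeDiff k τ j⟫ ≤
        ‖p‖ * (√(4 * (A + 2 * M * C * B) / c) * (n + 1 : ℕ)) :=
      (neg_le_abs _).trans ((abs_real_inner_le_norm _ _).trans
        (mul_le_mul_of_nonneg_left hqn (norm_nonneg _)))
    have e2 : (n : ℝ) * (2 * M * C / (n + 1 : ℕ) * ‖p‖) ≤ (n + 1 : ℕ) * (2 * M * C) * ‖p‖ := by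
      rw [← mul_assoc]
      refine mul_le_mul_of_nonneg_right ?_ (norm_nonneg _)
      have h3 : 2 * M * C / ((n + 1 : ℕ) : ℝ) ≤ 2 * M * C :=
        div_le_self (by positivity) hN1
      exact mul_le_mul (by simp) h3 (by positivity) (by positivity)
    rw [hK₁, div_mul_eq_mul_div, div_mul_eq_mul_div, le_div_iff₀ hα₀]
    linarith
  -- No second difference is centred at the end point 1. Its coefficient is recovered from ⟪p, k 1⟫,
  -- since R(1,1) ≠ 0 and the inner coefficients are already controlled.
  have hlast : |a (n + 1)| ≤ (B + B * B * K₁) / |R 1 1| * (n + 1 : ℕ) * ‖p‖ := by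
    have hpk : ⟪p, k 1⟫ = ∑ j ∈ Finset.range n, a (j + 1) * R (τ (j + 1)) 1 + a (n + 1) * R 1 1 := by
      rw [hp, inner_nodeComb hk hτ a h1, Finset.sum_range_succ, Finset.sum_range_succ', ha0,
        hτ.last]
      ring
    have e1 : |⟪p, k 1⟫| ≤ B * ‖p‖ := by
      rw [mul_comm]
      exact (abs_real_inner_le_norm _ _).trans (mul_le_mul_of_nonneg_left (hkB 1 h1) (norm_nonneg _))
    have e2 : |∑ j ∈ Finset.range n, a (j + 1) * R (τ (j + 1)) 1| ≤
        B * B * (K₁ * (n + 1 : ℕ) * ‖p‖) := by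
      refine (Finset.abs_sum_le_sum_abs _ _).trans ?_
      refine le_trans ?_ (mul_le_mul_of_nonneg_left hinner (mul_nonneg hB0 hB0))
      rw [Finset.mul_sum]
      refine Finset.sum_le_sum fun j hj => ?_
      have hmem := hτ.mem_Icc (l := j + 1) (by simp at hj; omega)
      rw [abs_mul, mul_comm, ← hk.inner_eq _ hmem _ h1]
      refine mul_le_mul_of_nonneg_right ?_ (abs_nonneg _)
      exact (abs_real_inner_le_norm _ _).trans
        (mul_le_mul (hkB _ hmem) (hkB 1 h1) (norm_nonneg _) hB0)
    have e3 : |a (n + 1)| * |R 1 1| ≤ B * ‖p‖ + B * B * (K₁ * (n + 1 : ℕ) * ‖p‖) := by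
      rw [← abs_mul, show a (n + 1) * R 1 1 = ⟪p, k 1⟫ -
        ∑ j ∈ Finset.range n, a (j + 1) * R (τ (j + 1)) 1 by rw [hpk]; ring]
      exact (abs_sub _ _).trans (add_le_add e1 e2)
    have e4 : B * ‖p‖ ≤ B * (n + 1 : ℕ) * ‖p‖ :=
      mul_le_mul_of_nonneg_right (le_mul_of_one_le_right hB0 hN1) (norm_nonneg _)
    rw [div_mul_eq_mul_div, div_mul_eq_mul_div, le_div_iff₀ (abs_pos.2 hR1)]
    linarith
  rw [Finset.sum_range_succ, Finset.sum_range_succ', ha0, abs_zero]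
  linarith

end

open scoped RealInnerProductSpace

/-! ### The kernel `phi` -/

section Kernel

variable {K : ℝ → ℝ} {x h : ℝ}

lemma integral_rescaled (hh : 0 < h) (h0 : 0 ≤ x - h) (h1 : x + h ≤ 1) {G : ℝ → ℝ}
    (hG : ∀ u, u ∉ Icc (-1 : ℝ) 1 → G u = 0) :
    ∫ s in (0 : ℝ)..1, 1 / h * G ((x - s) / h) = ∫ u in (-1 : ℝ)..1, G u := by
  have hl : ∫ s in (0 : ℝ)..1, 1 / h * G ((x - s) / h) = ∫ s, 1 / h * G ((x - s) / h) := by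
    rw [intervalIntegral.integral_of_le zero_le_one, ← integral_Icc_eq_integral_Ioc]
    refine setIntegral_eq_integral_of_forall_compl_eq_zero fun s hs => ?_
    rw [hG, mul_zero]
    intro hmem
    rw [mem_Icc, le_div_iff₀ hh, div_le_iff₀ hh] at hmem
    exact hs ⟨by linarith [hmem.2], by linarith [hmem.1]⟩
  have hr : ∫ u in (-1 : ℝ)..1, G u = ∫ u, G u := by
    rw [intervalIntegral.integral_of_le (by norm_num), ← integral_Icc_eq_integral_Ioc]
    exact setIntegral_eq_integral_of_forall_compl_eq_zero hG
  rw [hl, hr, integral_const_mul, integral_sub_left_eq_self (fun s => G (s / h)),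
    Measure.integral_comp_div, abs_of_pos hh, smul_eq_mul]
  field_simp

lemma phi_eq_zero (hK : IsFirstOrderKernel K) (hh : 0 < h) {s : ℝ}
    (hs : s ∉ Icc (x - h) (x + h)) : phi K x h s = 0 := by
  rw [phi, hK.support, mul_zero]
  intro hmem
  rw [mem_Icc, le_div_iff₀ hh, div_le_iff₀ hh] at hmem
  exact hs ⟨by linarith [hmem.2], by linarith [hmem.1]⟩

lemma IsFirstOrderKernel.integrable (hK : IsFirstOrderKernel K) : Integrable K := by
  have h1 : IntegrableOn K (Icc (-1) 1) := hK.contDiffOn.continuousOn.integrableOn_Icc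
  exact integrableOn_univ.1 (h1.of_forall_sdiff_eq_zero MeasurableSet.univ
    fun u hu => hK.support u hu.2)

lemma phi_intervalIntegrable (hK : IsFirstOrderKernel K) (hh : 0 < h) (a b : ℝ) :
    IntervalIntegrable (phi K x h) volume a b := by
  have h1 : Integrable (fun s => K ((x - s) / h)) :=
    (hK.integrable.comp_div hh.ne').comp_sub_left x
  exact (h1.const_mul (1 / h)).intervalIntegrable

lemma integral_phi (hK : IsFirstOrderKernel K) (hh : 0 < h) (h0 : 0 ≤ x - h) (h1 : x + h ≤ 1) :
    ∫ s in (0 : ℝ)..1, phi K x h s = 1 := by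
  exact (integral_rescaled hh h0 h1 hK.support).trans hK.integral_eq_one

lemma integral_phi_mul_sub (hK : IsFirstOrderKernel K) (hh : 0 < h) (h0 : 0 ≤ x - h)
    (h1 : x + h ≤ 1) : ∫ s in (0 : ℝ)..1, phi K x h s * (s - x) = 0 := by
  have hz : ∫ s in (0 : ℝ)..1, 1 / h * (((x - s) / h) * K ((x - s) / h)) = 0 := by
    exact (integral_rescaled (G := fun u => u * K u) hh h0 h1
      fun u hu => by simp [hK.support u hu]).trans hK.integral_id_mul
  have : (fun s => phi K x h s * (s - x)) =
      fun s => -h * (1 / h * (((x - s) / h) * K ((x - s) / h))) := by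
    ext s; rw [phi]; field_simp; ring
  rw [this, intervalIntegral.integral_const_mul, hz, mul_zero]

lemma integral_abs_phi (hK : IsFirstOrderKernel K) (hh : 0 < h) (h0 : 0 ≤ x - h)
    (h1 : x + h ≤ 1) : ∫ s in (0 : ℝ)..1, |phi K x h s| = ∫ u in (-1 : ℝ)..1, |K u| := by
  rw [← integral_rescaled (G := fun u => |K u|) hh h0 h1 fun u hu => by simp [hK.support u hu]]
  simp [phi, abs_mul, abs_of_pos hh]

end Kernel

/-! ### The interpolatory quadrature rule for a weight function -/

/-- The weight of the left end point of the `i`-th cell. -/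
def hatLeft (φ : ℝ → ℝ) (τ : ℕ → ℝ) (i : ℕ) : ℝ :=
  ∫ s in τ i..τ (i + 1), φ s * ((τ (i + 1) - s) / (τ (i + 1) - τ i))

/-- The weight of the right end point of the `i`-th cell. -/
def hatRight (φ : ℝ → ℝ) (τ : ℕ → ℝ) (i : ℕ) : ℝ :=
  ∫ s in τ i..τ (i + 1), φ s * ((s - τ i) / (τ (i + 1) - τ i))

/-- The integral of `φ` times the piecewise linear interpolant of the values `q` at the nodes. -/
def quad {E : Type*} [AddCommGroup E] [Module ℝ E] (φ : ℝ → ℝ) (τ : ℕ → ℝ) (n : ℕ) (q : ℕ → E) :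
    E :=
  ∑ i ∈ Finset.range n, (hatLeft φ τ i • q i + hatRight φ τ i • q (i + 1))

/-- The coefficients of the quadrature rule at the nodes. -/
def quadCoeff (φ : ℝ → ℝ) (τ : ℕ → ℝ) (n : ℕ) : ℕ → ℝ
  | 0 => if 0 < n then hatLeft φ τ 0 else 0
  | l + 1 => (if l + 1 < n then hatLeft φ τ (l + 1) else 0) + hatRight φ τ l

/-- Regrouping from nodes to cells. The values lie in an arbitrary module because the rule is
applied both to real functions and to the kernel vectors. -/
lemma sum_quadCoeff {E : Type*} [AddCommGroup E] [Module ℝ E] (φ : ℝ → ℝ) (τ : ℕ → ℝ) (n : ℕ)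
    (q : ℕ → E) : ∑ l ∈ Finset.range (n + 1), quadCoeff φ τ n l • q l = quad φ τ n q := by
  have h1 : ∑ l ∈ Finset.range (n + 1), (if l < n then hatLeft φ τ l else 0) • q l =
      ∑ i ∈ Finset.range n, hatLeft φ τ i • q i := by
    rw [Finset.sum_range_succ, if_neg (lt_irrefl n), zero_smul, add_zero]
    exact Finset.sum_congr rfl fun i hi => by rw [if_pos (by simpa using hi)]
  rw [quad, Finset.sum_add_distrib, ← h1, Finset.sum_range_succ', Finset.sum_range_succ' _ n,
    add_right_comm, ← Finset.sum_add_distrib]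
  simp only [quadCoeff, add_smul]

section Quad

variable {φ : ℝ → ℝ} {τ : ℕ → ℝ} {n : ℕ} {c C : ℝ}

lemma intervalIntegrable_mul_cell (hφ : ∀ a b, IntervalIntegrable φ volume a b)
    (hτ : IsMesh τ n c C) {q : ℝ → ℝ} {i : ℕ} (hi : i < n)
    (hq : ContinuousOn q (Icc (τ i) (τ (i + 1)))) :
    IntervalIntegrable (fun s => φ s * q s) volume (τ i) (τ (i + 1)) := by
  refine (hφ _ _).mul_continuousOn ?_
  rwa [uIcc_of_le (hτ.le_of_le (Nat.le_succ i) hi)]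

lemma abs_integral_sub_quad_le (hφ : ∀ a b, IntervalIntegrable φ volume a b)
    (hτ : IsMesh τ n c C) {q : ℝ → ℝ} {e : ℝ}
    (hq : ∀ i < n, ContinuousOn q (Icc (τ i) (τ (i + 1))))
    (he : ∀ i < n, ∀ s ∈ Icc (τ i) (τ (i + 1)), |q s - ((τ (i + 1) - s) / (τ (i + 1) - τ i) * q (τ i)
      + (s - τ i) / (τ (i + 1) - τ i) * q (τ (i + 1)))| ≤ e) :
    |(∫ s in (0 : ℝ)..1, φ s * q s) - quad φ τ n (fun l => q (τ l))| ≤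
      e * ∫ s in (0 : ℝ)..1, |φ s| := by
  have hint := fun i (hi : i ∈ Finset.range n) =>
    intervalIntegrable_mul_cell hφ hτ (Finset.mem_range.1 hi) (hq i (Finset.mem_range.1 hi))
  rw [← hτ.zero, ← hτ.last,
    ← intervalIntegral.sum_integral_adjacent_intervals
      (fun i hi => hint i (Finset.mem_range.2 hi)),
    ← intervalIntegral.sum_integral_adjacent_intervals (fun i _ => (hφ _ _).abs), quad,
    ← Finset.sum_sub_distrib, Finset.mul_sum]
  refine (Finset.abs_sum_le_sum_abs _ _).trans (Finset.sum_le_sum fun i hi => ?_)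
  have hi' := Finset.mem_range.1 hi
  have hle := hτ.le_of_le (Nat.le_succ i) hi'
  have hL : IntervalIntegrable (fun s => φ s * ((τ (i + 1) - s) / (τ (i + 1) - τ i))) volume
      (τ i) (τ (i + 1)) := intervalIntegrable_mul_cell hφ hτ hi' (by fun_prop)
  have hR : IntervalIntegrable (fun s => φ s * ((s - τ i) / (τ (i + 1) - τ i))) volume
      (τ i) (τ (i + 1)) := intervalIntegrable_mul_cell hφ hτ hi' (by fun_prop)
  rw [hatLeft, hatRight, smul_eq_mul, smul_eq_mul, ← intervalIntegral.integral_mul_const,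
    ← intervalIntegral.integral_mul_const,
    ← intervalIntegral.integral_add (hL.mul_const _) (hR.mul_const _),
    ← intervalIntegral.integral_sub (hint i hi) ((hL.mul_const _).add (hR.mul_const _)),
    ← intervalIntegral.integral_const_mul, ← Real.norm_eq_abs]
  refine intervalIntegral.norm_integral_le_of_norm_le hle ?_ ((hφ _ _).abs.const_mul e)
  refine ae_of_all _ fun s hs => ?_
  have h := he i hi' s ⟨hs.1.le, hs.2⟩
  rw [Real.norm_eq_abs, show φ s * q s - (φ s * ((τ (i + 1) - s) / (τ (i + 1) - τ i)) * q (τ i) +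
    φ s * ((s - τ i) / (τ (i + 1) - τ i)) * q (τ (i + 1))) = φ s * (q s -
      ((τ (i + 1) - s) / (τ (i + 1) - τ i) * q (τ i) +
        (s - τ i) / (τ (i + 1) - τ i) * q (τ (i + 1)))) by ring, abs_mul, mul_comm e]
  exact mul_le_mul_of_nonneg_left h (abs_nonneg _)

/-- Linear interpolation reproduces constants. The scalar case, with interpolation error 0, gives
the total weight, and this suffices for vectors. -/
lemma quad_const (hφ : ∀ a b, IntervalIntegrable φ volume a b) (hτ : IsMesh τ n c C)
    {E : Type*} [AddCommGroup E] [Module ℝ E] (v : E) :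
    quad φ τ n (fun _ => v) = (∫ s in (0 : ℝ)..1, φ s) • v := by
  have h := abs_integral_sub_quad_le (q := fun _ => 1) (e := 0) hφ hτ
    (fun i _ => continuousOn_const) fun i hi s _ => by
      have := (hτ.gap_pos hi).ne'
      rw [show (1 : ℝ) - ((τ (i + 1) - s) / (τ (i + 1) - τ i) * 1 +
        (s - τ i) / (τ (i + 1) - τ i) * 1) = 0 by field_simp; ring, abs_zero]
  rw [zero_mul, abs_nonpos_iff, sub_eq_zero] at h
  simp only [mul_one] at h
  rw [h, quad, quad, Finset.sum_smul]
  exact Finset.sum_congr rfl fun i _ => by simp [add_smul]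

/-- Cells on which φ vanishes have zero weights, so a bound on q is needed only near the support of
φ. On the other cells the two hat functions are nonnegative with sum 1. -/
lemma norm_quad_le (hφ : ∀ a b, IntervalIntegrable φ volume a b) (hτ : IsMesh τ n c C)
    {E : Type*} [NormedAddCommGroup E] [NormedSpace ℝ E] {q : ℕ → E} {B : ℝ}
    (hq : ∀ i < n, ∀ s ∈ Icc (τ i) (τ (i + 1)), φ s ≠ 0 → ‖q i‖ ≤ B ∧ ‖q (i + 1)‖ ≤ B) :
    ‖quad φ τ n q‖ ≤ B * ∫ s in (0 : ℝ)..1, |φ s| := by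
  rw [← hτ.zero, ← hτ.last,
    ← intervalIntegral.sum_integral_adjacent_intervals (fun i _ => (hφ _ _).abs), quad,
    Finset.mul_sum]
  refine (norm_sum_le _ _).trans (Finset.sum_le_sum fun i hi => ?_)
  have hi' := Finset.mem_range.1 hi
  have hle := hτ.le_of_le (Nat.le_succ i) hi'
  have hgap := hτ.gap_pos hi'
  by_cases hne : ∃ s ∈ Icc (τ i) (τ (i + 1)), φ s ≠ 0
  · obtain ⟨s, hs, hφs⟩ := hne
    obtain ⟨h1, h2⟩ := hq i hi' s hs hφs
    have hB0 := (norm_nonneg _).trans h1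
    have hwL : IntervalIntegrable (fun s => |φ s| * ((τ (i + 1) - s) / (τ (i + 1) - τ i))) volume
      (τ i) (τ (i + 1)) :=
      intervalIntegrable_mul_cell (fun a b => (hφ a b).abs) hτ hi' (by fun_prop)
    have hwR : IntervalIntegrable (fun s => |φ s| * ((s - τ i) / (τ (i + 1) - τ i))) volume
      (τ i) (τ (i + 1)) :=
      intervalIntegrable_mul_cell (fun a b => (hφ a b).abs) hτ hi' (by fun_prop)
    have hL : ‖hatLeft φ τ i‖ ≤
        ∫ s in τ i..τ (i + 1), |φ s| * ((τ (i + 1) - s) / (τ (i + 1) - τ i)) := by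
      refine intervalIntegral.norm_integral_le_of_norm_le hle (ae_of_all _ fun s hs => ?_) hwL
      rw [norm_mul, Real.norm_eq_abs, Real.norm_of_nonneg]
      exact div_nonneg (by linarith [hs.2]) hgap.le
    have hR : ‖hatRight φ τ i‖ ≤
        ∫ s in τ i..τ (i + 1), |φ s| * ((s - τ i) / (τ (i + 1) - τ i)) := by
      refine intervalIntegral.norm_integral_le_of_norm_le hle (ae_of_all _ fun s hs => ?_) hwR
      rw [norm_mul, Real.norm_eq_abs, Real.norm_of_nonneg]
      exact div_nonneg (by linarith [hs.1]) hgap.le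
    have hsum : ∫ s in τ i..τ (i + 1), |φ s| =
        (∫ s in τ i..τ (i + 1), |φ s| * ((τ (i + 1) - s) / (τ (i + 1) - τ i))) +
        ∫ s in τ i..τ (i + 1), |φ s| * ((s - τ i) / (τ (i + 1) - τ i)) := by
      rw [← intervalIntegral.integral_add hwL hwR]
      refine intervalIntegral.integral_congr fun s _ => ?_
      have := hgap.ne'
      field_simp
      ring
    calc ‖hatLeft φ τ i • q i + hatRight φ τ i • q (i + 1)‖
        ≤ ‖hatLeft φ τ i‖ * ‖q i‖ + ‖hatRight φ τ i‖ * ‖q (i + 1)‖ := by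
          rw [← norm_smul, ← norm_smul]; exact norm_add_le _ _
      _ ≤ ‖hatLeft φ τ i‖ * B + ‖hatRight φ τ i‖ * B := by gcongr
      _ ≤ B * ∫ s in τ i..τ (i + 1), |φ s| := by
          rw [hsum, ← add_mul, mul_comm]
          exact mul_le_mul_of_nonneg_left (add_le_add hL hR) hB0
  · push Not at hne
    have hz : ∀ w : ℝ → ℝ, ∫ s in τ i..τ (i + 1), φ s * w s = 0 := fun w =>
      intervalIntegral.integral_zero_ae (ae_of_all _ fun s hs => by
        rw [uIoc_of_le hle] at hs
        rw [hne s ⟨hs.1.le, hs.2⟩, zero_mul])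
    have hz' : ∫ s in τ i..τ (i + 1), |φ s| = 0 :=
      intervalIntegral.integral_zero_ae (ae_of_all _ fun s hs => by
        rw [uIoc_of_le hle] at hs
        rw [hne s ⟨hs.1.le, hs.2⟩, abs_zero])
    rw [hatLeft, hatRight, hz, hz, hz']
    simp

end Quad

open scoped RealInnerProductSpace

/-! ### Comparison of the projection weights with the quadrature weights -/

section Weights

variable {R : ℝ → ℝ → ℝ} {k : ℝ → H} {M : ℝ} {τ : ℕ → ℝ} {n : ℕ} {c C : ℝ} {φ : ℝ → ℝ}

/-- The weights `W` at the nodes `τ 1, …, τ n` solve the normal equations for the function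
`t ↦ ∫ R(s,t) φ(s) ds`. -/
structure SolvesNormalEquations (R : ℝ → ℝ → ℝ) (φ : ℝ → ℝ) (τ : ℕ → ℝ) (n : ℕ) (W : ℕ → ℝ) :
    Prop where
  zero : W 0 = 0
  eq : ∀ j, 0 < j → j ≤ n → ∑ l ∈ Finset.range (n + 1), W l * R (τ l) (τ j) =
    ∫ s in (0 : ℝ)..1, R s (τ j) * φ s

lemma nodeComb_sub (k : ℝ → H) (τ : ℕ → ℝ) (n : ℕ) (a b : ℕ → ℝ) :
    nodeComb k τ n (a - b) = nodeComb k τ n a - nodeComb k τ n b := by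
  simp [nodeComb, sub_smul, Finset.sum_sub_distrib]

/-- A Galerkin argument: the normal equations allow testing against p itself, so ‖p‖² is a
quadrature error for u ↦ ⟪p, k u⟫. That error is again proportional to ‖p‖, and one factor cancels.
-/
lemma norm_nodeComb_sub_quadCoeff_le (hk : IsKernelFamily R k M) (hA : AssumptionA R)
    (hτ : IsMesh τ n c C) (hφ : ∀ a b, IntervalIntegrable φ volume a b) {W : ℕ → ℝ}
    (hW : SolvesNormalEquations R φ τ n W) (h0 : quadCoeff φ τ n 0 = 0) :
    ‖nodeComb k τ n (W - quadCoeff φ τ n)‖ ≤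
      M * (C / n) ^ 2 * ∫ s in (0 : ℝ)..1, |φ s| := by
  set a := W - quadCoeff φ τ n with ha
  set p := nodeComb k τ n a with hp
  have ha0 : a 0 = 0 := by simp [ha, hW.zero, h0]
  have hmem : ∀ l ∈ Finset.range (n + 1), τ l ∈ Icc (0 : ℝ) 1 := fun l hl =>
    hτ.mem_Icc (by simpa [Nat.lt_succ_iff] using hl)
  have hint : ∀ l ∈ Finset.range (n + 1),
      IntervalIntegrable (fun s => a l * (R s (τ l) * φ s)) volume 0 1 := by
    intro l hl
    refine IntervalIntegrable.const_mul (IntervalIntegrable.continuousOn_mul (hφ 0 1) ?_) _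
    rw [uIcc_of_le zero_le_one]
    exact (hA.continuousOn_right (hmem l hl)).congr fun s hs => hk.symm hs (hmem l hl)
  have h1 : ⟪nodeComb k τ n W, p⟫ = ∫ s in (0 : ℝ)..1, φ s * ⟪p, k s⟫ := by
    have : ∫ s in (0 : ℝ)..1, φ s * ⟪p, k s⟫ =
        ∫ s in (0 : ℝ)..1, ∑ l ∈ Finset.range (n + 1), a l * (R s (τ l) * φ s) := by
      refine intervalIntegral.integral_congr fun s hs => ?_
      rw [uIcc_of_le zero_le_one] at hs
      rw [hp, inner_nodeComb hk hτ a hs, Finset.mul_sum]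
      refine Finset.sum_congr rfl fun l hl => ?_
      rw [hk.symm (hmem l hl) hs]; ring
    rw [this, intervalIntegral.integral_finsetSum hint, hp, nodeComb, nodeComb, inner_sum]
    refine Finset.sum_congr rfl fun l hl => ?_
    rw [intervalIntegral.integral_const_mul, real_inner_smul_right]
    -- The normal equations hold only at nodes of positive index; node 0 is harmless because a 0 =
    -- 0.
    rcases l with _ | l
    · rw [ha0, zero_mul, zero_mul]
    · rw [← hW.eq (l + 1) (Nat.succ_pos l) (by simpa using hl), ← inner_nodeComb hk hτ W (hmem _ hl),
        nodeComb]
  have h2 : ⟪nodeComb k τ n (quadCoeff φ τ n), p⟫ = quad φ τ n (fun l => ⟪p, k (τ l)⟫) := by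
    rw [← sum_quadCoeff, nodeComb, sum_inner]
    exact Finset.sum_congr rfl fun l _ => by
      rw [real_inner_smul_left, smul_eq_mul, real_inner_comm]
  have h3 : ‖p‖ ^ 2 = (∫ s in (0 : ℝ)..1, φ s * ⟪p, k s⟫) -
      quad φ τ n (fun l => ⟪p, k (τ l)⟫) := by
    rw [← h1, ← h2, ← inner_sub_left, ← nodeComb_sub, real_inner_self_eq_norm_sq]
  have h4 := abs_integral_sub_quad_le (q := fun s => ⟪p, k s⟫) hφ hτ
    (fun i hi => (nodeComb_cell hk hA hτ a hi).1)
    (fun i hi s hs => nodeComb_interpolation hk hA hτ a hi hs)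
  rw [← h3, abs_of_nonneg (sq_nonneg _)] at h4
  rcases (norm_nonneg p).eq_or_lt with hp0 | hp0
  · rw [← hp0]
    have := hk.bound_nonneg
    have : 0 ≤ ∫ s in (0 : ℝ)..1, |φ s| :=
      intervalIntegral.integral_nonneg zero_le_one fun s _ => abs_nonneg _
    positivity
  · refine le_of_mul_le_mul_left ?_ hp0
    calc ‖p‖ * ‖p‖ = ‖p‖ ^ 2 := (sq _).symm
      _ ≤ _ := h4
      _ = _ := by ring

end Weights

/-! ### Functions of class `C²` on `[0,1]` -/

lemma exists_second_derivative_bound {g : ℝ → ℝ} (hg : ContDiffOn ℝ 2 g (Icc 0 1)) :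
    ∃ (g' g'' : ℝ → ℝ) (B : ℝ), 0 ≤ B ∧ ContinuousOn g (Icc 0 1) ∧
      (∀ u ∈ Ioo (0 : ℝ) 1, HasDerivAt g (g' u) u) ∧
      (∀ u ∈ Ioo (0 : ℝ) 1, HasDerivAt g' (g'' u) u) ∧
      (∀ u ∈ Ioo (0 : ℝ) 1, |g'' u| ≤ B) ∧ ∀ u ∈ Icc (0 : ℝ) 1, |g u| ≤ B := by
  have hu := uniqueDiffOn_Icc (zero_lt_one' ℝ)
  have h1 : ContDiffOn ℝ 1 (derivWithin g (Icc 0 1)) (Icc 0 1) :=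
    hg.derivWithin hu (by norm_num)
  have h2 : ContDiffOn ℝ 0 (derivWithin (derivWithin g (Icc 0 1)) (Icc 0 1)) (Icc 0 1) :=
    h1.derivWithin hu (by norm_num)
  obtain ⟨B, hB⟩ := isCompact_Icc.exists_bound_of_continuousOn h2.continuousOn
  obtain ⟨B', hB'⟩ := isCompact_Icc.exists_bound_of_continuousOn hg.continuousOn
  refine ⟨derivWithin g (Icc 0 1), _, max B B', ?_, hg.continuousOn, fun u hu => ?_, fun u hu => ?_,
    fun u hu => (hB u (Ioo_subset_Icc_self hu)).trans (le_max_left _ _),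
    fun u hu => (hB' u hu).trans (le_max_right _ _)⟩
  · exact (norm_nonneg _).trans ((hB 0 (by simp)).trans (le_max_left _ _))
  · exact ((hg.differentiableOn two_ne_zero u (Ioo_subset_Icc_self hu)).hasDerivWithinAt).hasDerivAt
      (Icc_mem_nhds hu.1 hu.2)
  · exact ((h1.differentiableOn one_ne_zero u (Ioo_subset_Icc_self hu)).hasDerivWithinAt).hasDerivAt
      (Icc_mem_nhds hu.1 hu.2)

lemma abs_taylor_le {g g' g'' : ℝ → ℝ} {B : ℝ} (hB0 : 0 ≤ B)
    (h1 : ∀ u ∈ Ioo (0 : ℝ) 1, HasDerivAt g (g' u) u)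
    (h2 : ∀ u ∈ Ioo (0 : ℝ) 1, HasDerivAt g' (g'' u) u)
    (hB : ∀ u ∈ Ioo (0 : ℝ) 1, |g'' u| ≤ B) {x s : ℝ} (hx : x ∈ Ioo (0 : ℝ) 1)
    (hs : s ∈ Ioo (0 : ℝ) 1) : |g s - g x - g' x * (s - x)| ≤ B * (s - x) ^ 2 := by
  have hsub : uIcc x s ⊆ Ioo 0 1 := (convex_Ioo (0 : ℝ) 1).ordConnected.uIcc_subset hx hs
  have hG : ∀ u ∈ uIcc x s, HasDerivWithinAt (fun u => g u - g' x * u) (g' u - g' x) (uIcc x s) u :=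
    fun u hu => by
      have := ((h1 u (hsub hu)).sub ((hasDerivAt_id u).const_mul (g' x))).hasDerivWithinAt
        (s := uIcc x s)
      simpa only [mul_one, id_eq] using! this
  have hb : ∀ u ∈ uIcc x s, ‖g' u - g' x‖ ≤ B * |s - x| := fun u hu => by
    have h := (convex_uIcc x s).norm_image_sub_le_of_norm_hasDerivWithin_le
      (fun v hv => (h2 v (hsub hv)).hasDerivWithinAt) (fun v hv => hB v (hsub hv)) left_mem_uIcc hu
    refine h.trans (mul_le_mul_of_nonneg_left ?_ hB0)
    rw [Real.norm_eq_abs]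
    exact abs_sub_left_of_mem_uIcc hu
  have h := (convex_uIcc x s).norm_image_sub_le_of_norm_hasDerivWithin_le hG hb left_mem_uIcc
    right_mem_uIcc
  rw [Real.norm_eq_abs, Real.norm_eq_abs, mul_assoc, ← sq, sq_abs] at h
  rwa [show g s - g x - g' x * (s - x) = g s - g' x * s - (g x - g' x * x) by ring]

/-! ### Bias and mean square error of the weights -/

section Bounds

variable {R : ℝ → ℝ → ℝ} {k : ℝ → H} {M : ℝ} {τ : ℕ → ℝ} {n : ℕ} {c C : ℝ} {K : ℝ → ℝ}
  {x h : ℝ}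

/-- The node 0 is not a design point. Once the support of φ clears the first cell, the quadrature
rule does not use it either, and its coefficients are comparable with the projection weights. -/
lemma quadCoeff_phi_zero (hK : IsFirstOrderKernel K) (hτ : IsMesh τ n c C) (hh : 0 < h)
    (hx : C / n < x - h) : quadCoeff (phi K x h) τ n 0 = 0 := by
  have hle := hτ.le_of_le (Nat.le_succ 0) hτ.pos
  have h1 := hτ.upper 0 hτ.pos
  rw [quadCoeff, if_pos hτ.pos, hatLeft]
  refine intervalIntegral.integral_zero_ae (ae_of_all _ fun s hs => ?_)
  rw [uIoc_of_le hle] at hs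
  rw [phi_eq_zero hK hh, zero_mul]
  intro hmem
  have h0 := hτ.zero
  linarith [hmem.1, hs.2]

lemma abs_integral_phi_mul_sub_le (hK : IsFirstOrderKernel K) {g g' g'' : ℝ → ℝ} {B : ℝ}
    (hB0 : 0 ≤ B) (hgc : ContinuousOn g (Icc 0 1))
    (h1 : ∀ u ∈ Ioo (0 : ℝ) 1, HasDerivAt g (g' u) u)
    (h2 : ∀ u ∈ Ioo (0 : ℝ) 1, HasDerivAt g' (g'' u) u)
    (hB : ∀ u ∈ Ioo (0 : ℝ) 1, |g'' u| ≤ B) (hx : x ∈ Ioo (0 : ℝ) 1) (hh : 0 < h)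
    (hl : 0 < x - h) (hr : x + h < 1) :
    |(∫ s in (0 : ℝ)..1, phi K x h s * g s) - g x| ≤
      B * h ^ 2 * ∫ s in (0 : ℝ)..1, |phi K x h s| := by
  have hφ := phi_intervalIntegrable (x := x) hK hh
  have hi1 : IntervalIntegrable (fun s => phi K x h s * g s) volume 0 1 :=
    (hφ 0 1).mul_continuousOn (by rwa [uIcc_of_le zero_le_one])
  have hi2 : IntervalIntegrable (fun s => phi K x h s * g x) volume 0 1 := (hφ 0 1).mul_const _
  have hi3 : IntervalIntegrable (fun s => phi K x h s * (s - x) * g' x) volume 0 1 :=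
    ((hφ 0 1).mul_continuousOn (by fun_prop)).mul_const _
  have e : (∫ s in (0 : ℝ)..1, phi K x h s * g s) - g x =
      ∫ s in (0 : ℝ)..1, (phi K x h s * g s - phi K x h s * g x - phi K x h s * (s - x) * g' x) := by
    rw [intervalIntegral.integral_sub (hi1.sub hi2) hi3, intervalIntegral.integral_sub hi1 hi2,
      intervalIntegral.integral_mul_const, intervalIntegral.integral_mul_const,
      integral_phi hK hh hl.le hr.le, integral_phi_mul_sub hK hh hl.le hr.le]
    ring
  rw [e, ← intervalIntegral.integral_const_mul, ← Real.norm_eq_abs]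
  refine intervalIntegral.norm_integral_le_of_norm_le zero_le_one (ae_of_all _ fun s _ => ?_)
    ((hφ 0 1).abs.const_mul _)
  rw [Real.norm_eq_abs, show phi K x h s * g s - phi K x h s * g x - phi K x h s * (s - x) * g' x =
    (g s - g x - g' x * (s - x)) * phi K x h s by ring, abs_mul]
  by_cases hs : s ∈ Icc (x - h) (x + h)
  · refine mul_le_mul_of_nonneg_right ?_ (abs_nonneg _)
    refine (abs_taylor_le hB0 h1 h2 hB hx ⟨hl.trans_le hs.1, hs.2.trans_lt hr⟩).trans ?_
    refine mul_le_mul_of_nonneg_left ?_ hB0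
    rw [sq_le_sq, abs_of_pos hh, abs_le]
    constructor <;> linarith [hs.1, hs.2]
  · rw [phi_eq_zero hK hh hs]; simp

/-- The bias of weights solving the normal equations. -/
lemma exists_bias_le (hk : IsKernelFamily R k M) (hA : AssumptionA R) (hB : AssumptionB R)
    (hR1 : R 1 1 ≠ 0) (hK : IsFirstOrderKernel K) {g : ℝ → ℝ} (hg : ContDiffOn ℝ 2 g (Icc 0 1))
    (hx : x ∈ Ioo (0 : ℝ) 1) (c C : ℝ) :
    ∃ D : ℝ, ∀ (τ : ℕ → ℝ) (n : ℕ) (h : ℝ) (W : ℕ → ℝ), IsMesh τ n c C → 0 < h →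
      C / n < x - h → x + h < 1 → SolvesNormalEquations R (phi K x h) τ n W →
      |∑ l ∈ Finset.range (n + 1), W l * g (τ l) - g x| ≤ D * (1 / n + h ^ 2) := by
  obtain ⟨Q, hQ⟩ := exists_sum_abs_le hk hA hB hR1 c C
  obtain ⟨g', g'', B, hB0, hgc, h1, h2, hgB, hgb⟩ := exists_second_derivative_bound hg
  set L := ∫ u in (-1 : ℝ)..1, |K u| with hL
  refine ⟨B * |Q| * (M * C ^ 2 * L) + B * C ^ 2 * L + B * L, fun τ n h W hτ hh hl hr hW => ?_⟩
  have hN := hτ.cast_pos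
  have hC := hτ.upper_pos
  have hM := hk.bound_nonneg
  have hl0 : 0 < x - h := (div_pos hC hN).trans hl
  have hφ := phi_intervalIntegrable (x := x) hK hh
  have hLφ : ∫ s in (0 : ℝ)..1, |phi K x h s| = L := integral_abs_phi hK hh hl0.le hr.le
  have hL0 : 0 ≤ L := intervalIntegral.integral_nonneg (by norm_num) fun _ _ => abs_nonneg _
  have hq0 := quadCoeff_phi_zero hK hτ hh hl
  set φ := phi K x h with hφd
  have hp := norm_nodeComb_sub_quadCoeff_le hk hA hτ hφ hW hq0
  rw [hLφ] at hp
  set a := W - quadCoeff φ τ n with ha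
  -- The factor n of the ℓ¹ bound meets ‖p‖ = O(n⁻²), which leaves 1/n.
  have e1 : |∑ l ∈ Finset.range (n + 1), a l * g (τ l)| ≤ B * |Q| * (M * C ^ 2 * L) * (1 / n) := by
    have hsum := hQ τ n hτ a (by simp [ha, hW.zero, hq0])
    calc |∑ l ∈ Finset.range (n + 1), a l * g (τ l)|
        ≤ ∑ l ∈ Finset.range (n + 1), B * |a l| := by
          refine (Finset.abs_sum_le_sum_abs _ _).trans (Finset.sum_le_sum fun l hl => ?_)
          rw [abs_mul, mul_comm]
          exact mul_le_mul_of_nonneg_right (hgb _ (hτ.mem_Icc (by simpa [Nat.lt_succ_iff] using hl)))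
            (abs_nonneg _)
      _ ≤ B * (|Q| * n * (M * (C / n) ^ 2 * L)) := by
          rw [← Finset.mul_sum]
          refine mul_le_mul_of_nonneg_left (hsum.trans ?_) hB0
          gcongr
          exact le_abs_self Q
      _ = _ := by field_simp
  have e2 : |(∫ s in (0 : ℝ)..1, φ s * g s) - quad φ τ n (fun l => g (τ l))| ≤
      B * (C / n) ^ 2 * L := by
    rw [← hLφ]
    refine abs_integral_sub_quad_le hφ hτ (fun i hi => hgc.mono (hτ.Icc_subset hi))
      fun i hi s hs => ?_
    have hsub := hτ.Ioo_subset hi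
    refine (abs_sub_linear_interpolation_le (sub_pos.1 (hτ.gap_pos hi))
      (hgc.mono (hτ.Icc_subset hi)) (fun u hu => h1 u (hsub hu)) (fun u hu => h2 u (hsub hu))
      (fun u hu => hgB u (hsub hu)) hs).trans ?_
    have := hτ.gap_pos hi
    have := hτ.upper i hi
    gcongr
  have e3 := abs_integral_phi_mul_sub_le hK hB0 hgc h1 h2 hgB hx hh hl0 hr
  rw [← hφd, hLφ] at e3
  have e2' : B * (C / n) ^ 2 * L ≤ B * C ^ 2 * L * (1 / n) := by
    have hn1 : (1 : ℝ) ≤ n := by exact_mod_cast hτ.pos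
    rw [div_pow, show B * (C ^ 2 / (n : ℝ) ^ 2) * L = B * C ^ 2 * L * (1 / (n : ℝ) ^ 2) by ring]
    have : (n : ℝ) ≤ (n : ℝ) ^ 2 := by nlinarith
    gcongr
  -- Three errors: replacing the weights by quadrature coefficients, the quadrature of φ g, and
  -- smoothing by φ.
  have hsplit : ∑ l ∈ Finset.range (n + 1), W l * g (τ l) - g x =
      ∑ l ∈ Finset.range (n + 1), a l * g (τ l)
        - ((∫ s in (0 : ℝ)..1, φ s * g s) - quad φ τ n (fun l => g (τ l)))
        + ((∫ s in (0 : ℝ)..1, φ s * g s) - g x) := by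
    rw [← sum_quadCoeff]
    simp only [ha, Pi.sub_apply, sub_mul, Finset.sum_sub_distrib, smul_eq_mul]
    ring
  rw [hsplit]
  refine (abs_add_le _ _).trans ((add_le_add_left (abs_sub _ _) _).trans ?_)
  have p1 : 0 ≤ (B * |Q| * (M * C ^ 2 * L) + B * C ^ 2 * L) * h ^ 2 := by positivity
  have p2 : 0 ≤ B * L * (1 / n) := by positivity
  linarith

/-- The distance in the Hilbert space between the projection and `k x`. -/
lemma exists_norm_nodeComb_sub_le (hk : IsKernelFamily R k M) (hA : AssumptionA R)
    (hK : IsFirstOrderKernel K) (x c C : ℝ) :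
    ∃ D : ℝ, ∀ (τ : ℕ → ℝ) (n : ℕ) (h : ℝ) (W : ℕ → ℝ) (η : ℝ), IsMesh τ n c C → 0 < h →
      C / n < x - h → x + h < 1 → SolvesNormalEquations R (phi K x h) τ n W →
      (∀ s, |s - x| ≤ h + C / n → ‖k s - k x‖ ≤ η) →
      ‖nodeComb k τ n W - k x‖ ≤ D * (1 / n + η) := by
  set L := ∫ u in (-1 : ℝ)..1, |K u| with hL
  refine ⟨M * C ^ 2 * L + L, fun τ n h W η hτ hh hl hr hW hη => ?_⟩
  have hN := hτ.cast_pos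
  have hC := hτ.upper_pos
  have hM := hk.bound_nonneg
  have hl0 : 0 < x - h := (div_pos hC hN).trans hl
  have hφ := phi_intervalIntegrable (x := x) hK hh
  have hLφ : ∫ s in (0 : ℝ)..1, |phi K x h s| = L := integral_abs_phi hK hh hl0.le hr.le
  have hL0 : 0 ≤ L := intervalIntegral.integral_nonneg (by norm_num) fun _ _ => abs_nonneg _
  have hη0 : 0 ≤ η := (norm_nonneg _).trans (hη x (by
    rw [sub_self, abs_zero]; exact add_nonneg hh.le (div_pos hC hN).le))
  have hp := norm_nodeComb_sub_quadCoeff_le hk hA hτ hφ hW (quadCoeff_phi_zero hK hτ hh hl)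
  -- The quadrature weights have sum ∫ φ = 1, so k x may be moved inside the rule.
  have e1 : nodeComb k τ n (quadCoeff (phi K x h) τ n) - k x =
      quad (phi K x h) τ n (fun l => k (τ l) - k x) := by
    have h1 := quad_const hφ hτ (k x)
    rw [integral_phi hK hh hl0.le hr.le, one_smul] at h1
    rw [nodeComb, sum_quadCoeff (q := fun l => k (τ l))]
    nth_rewrite 1 [← h1]
    rw [quad, quad, quad, ← Finset.sum_sub_distrib]
    exact Finset.sum_congr rfl fun i _ => by simp only [smul_sub]; abel
  have e2 : ‖quad (phi K x h) τ n (fun l => k (τ l) - k x)‖ ≤ η * L := by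
    rw [← hLφ]
    refine norm_quad_le hφ hτ fun i hi s hs hne => ?_
    have hsx : s ∈ Icc (x - h) (x + h) := by
      by_contra hcon; exact hne (phi_eq_zero hK hh hcon)
    have hgap := hτ.upper i hi
    constructor
    · refine hη _ (abs_le.2 ⟨?_, ?_⟩) <;> linarith [hs.1, hs.2, hsx.1, hsx.2]
    · refine hη _ (abs_le.2 ⟨?_, ?_⟩) <;> linarith [hs.1, hs.2, hsx.1, hsx.2]
  rw [hLφ, nodeComb_sub] at hp
  rw [← e1] at e2
  have e3 : M * (C / n) ^ 2 * L ≤ M * C ^ 2 * L * (1 / n) := by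
    have hn1 : (1 : ℝ) ≤ n := by exact_mod_cast hτ.pos
    rw [div_pow, show M * (C ^ 2 / (n : ℝ) ^ 2) * L = M * C ^ 2 * L * (1 / (n : ℝ) ^ 2) by ring]
    have : (n : ℝ) ≤ (n : ℝ) ^ 2 := by nlinarith
    gcongr
  have e4 := norm_add_le (nodeComb k τ n W - nodeComb k τ n (quadCoeff (phi K x h) τ n))
    (nodeComb k τ n (quadCoeff (phi K x h) τ n) - k x)
  rw [sub_add_sub_cancel] at e4
  have p1 : 0 ≤ M * C ^ 2 * L * η := by positivity
  have p2 : 0 ≤ L * (1 / n) := by positivity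
  linarith

end Bounds

open scoped RealInnerProductSpace

/-! ### The regular design -/

section Design

variable {f : ℝ → ℝ}

/-- The nodes `F⁻¹(i/n)`, `i = 0, …, n`. -/
def designNode (f : ℝ → ℝ) (n i : ℕ) : ℝ := Function.invFunOn (cdf f) (Icc 0 1) ((i : ℝ) / n)

lemma designPoint_eq (f : ℝ → ℝ) (n : ℕ) (i : Fin n) :
    designPoint f n i = designNode f n (i + 1) := by
  simp [designPoint, designNode]

lemma IsDesignDensity.intervalIntegrable (hf : IsDesignDensity f) {a b : ℝ}
    (ha : a ∈ Icc (0 : ℝ) 1) (hb : b ∈ Icc (0 : ℝ) 1) : IntervalIntegrable f volume a b :=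
  (hf.contDiffOn.continuousOn.mono (uIcc_subset_Icc ha hb)).intervalIntegrable

lemma IsDesignDensity.cdf_sub (hf : IsDesignDensity f) {a b : ℝ}
    (ha : a ∈ Icc (0 : ℝ) 1) (hb : b ∈ Icc (0 : ℝ) 1) :
    cdf f b - cdf f a = ∫ v in a..b, f v :=
  intervalIntegral.integral_interval_sub_left (hf.intervalIntegrable (by simp) hb)
    (hf.intervalIntegrable (by simp) ha)

lemma IsDesignDensity.exists_cdf_bounds (hf : IsDesignDensity f) :
    ∃ c > 0, ∃ C > 0, ∀ a ∈ Icc (0 : ℝ) 1, ∀ b ∈ Icc (0 : ℝ) 1, a ≤ b →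
      c * (b - a) ≤ cdf f b - cdf f a ∧ cdf f b - cdf f a ≤ C * (b - a) := by
  obtain ⟨c, hc, hcf⟩ := hf.inf_pos
  obtain ⟨C, hC⟩ := hf.bddAbove
  have hCf : ∀ t ∈ Ioo (0 : ℝ) 1, f t ≤ C := fun t ht => hC (mem_image_of_mem f ht)
  refine ⟨c, hc, C, ?_, fun a ha b hb hab => ?_⟩
  · exact hc.trans_le ((hcf (1 / 2) (by norm_num)).trans (hCf (1 / 2) (by norm_num)))
  · have hsub : ∀ t ∈ Ioo a b, t ∈ Ioo (0 : ℝ) 1 :=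
      fun t ht => ⟨ha.1.trans_lt ht.1, ht.2.trans_le hb.2⟩
    have hi := hf.intervalIntegrable ha hb
    rw [hf.cdf_sub ha hb]
    have h1 := intervalIntegral.integral_mono_on_of_le_Ioo hab
      (intervalIntegrable_const (c := c)) hi fun t ht => hcf t (hsub t ht)
    have h2 := intervalIntegral.integral_mono_on_of_le_Ioo hab hi
      (intervalIntegrable_const (c := C)) fun t ht => hCf t (hsub t ht)
    simp only [intervalIntegral.integral_const, smul_eq_mul] at h1 h2
    constructor <;> linarith

lemma IsDesignDensity.surjOn_cdf (hf : IsDesignDensity f) :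
    SurjOn (cdf f) (Icc 0 1) (Icc 0 1) := by
  have hc : ContinuousOn (cdf f) (Icc 0 1) := by
    have h := intervalIntegral.continuousOn_primitive_interval (f := f) (a := 0) (b := 1)
      (μ := volume) (by
        rw [uIcc_of_le zero_le_one]; exact hf.contDiffOn.continuousOn.integrableOn_Icc)
    rwa [uIcc_of_le zero_le_one] at h
  have h := intermediate_value_Icc zero_le_one hc
  rwa [show cdf f 0 = 0 by simp [cdf], show cdf f 1 = 1 from hf.integral_eq_one] at h

lemma IsDesignDensity.designNode_spec (hf : IsDesignDensity f) {n i : ℕ} (hn : 0 < n)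
    (hi : i ≤ n) :
    designNode f n i ∈ Icc (0 : ℝ) 1 ∧ cdf f (designNode f n i) = (i : ℝ) / n := by
  have hn' : (0 : ℝ) < n := by exact_mod_cast hn
  have hmem : (i : ℝ) / n ∈ cdf f '' Icc 0 1 := hf.surjOn_cdf
    ⟨by positivity, by rw [div_le_one hn']; exact_mod_cast hi⟩
  exact ⟨Function.invFunOn_mem hmem, Function.invFunOn_eq hmem⟩

lemma IsDesignDensity.designPoint_mem (hf : IsDesignDensity f) {n : ℕ} (i : Fin n) :
    designPoint f n i ∈ Icc (0 : ℝ) 1 := by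
  rw [designPoint_eq]
  exact (hf.designNode_spec i.pos i.isLt).1

/-- The distribution function is bi-Lipschitz with constants c and C, so increments 1/n of its
values correspond to gaps between 1/(Cn) and 1/(cn). -/
lemma IsDesignDensity.exists_isMesh (hf : IsDesignDensity f) :
    ∃ c C : ℝ, ∀ n : ℕ, 0 < n → IsMesh (designNode f n) n c C := by
  obtain ⟨c, hc, C, hC, hcdf⟩ := hf.exists_cdf_bounds
  have hinj : ∀ a ∈ Icc (0 : ℝ) 1, ∀ b ∈ Icc (0 : ℝ) 1, cdf f a ≤ cdf f b → a ≤ b := by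
    intro a ha b hb hab
    by_contra hba
    push Not at hba
    have := (hcdf b hb a ha hba.le).1
    have := mul_pos hc (sub_pos.2 hba)
    linarith
  refine ⟨1 / C, 1 / c, fun n hn => ?_⟩
  have hn' : (0 : ℝ) < n := by exact_mod_cast hn
  have hstep : ∀ i < n, c * (designNode f n (i + 1) - designNode f n i) ≤ 1 / n ∧
      1 / n ≤ C * (designNode f n (i + 1) - designNode f n i) := by
    intro i hi
    obtain ⟨h1, h2⟩ := hf.designNode_spec hn hi.le
    obtain ⟨h3, h4⟩ := hf.designNode_spec hn (i := i + 1) hi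
    have hd : cdf f (designNode f n (i + 1)) - cdf f (designNode f n i) = 1 / n := by
      rw [h2, h4]; push_cast; ring
    have hle := hinj _ h1 _ h3 (by have := one_div_pos.2 hn'; linarith)
    rw [← hd]
    exact hcdf _ h1 _ h3 hle
  refine ⟨hn, one_div_pos.2 hC, ?_, ?_, fun i hi => ?_, fun i hi => ?_⟩
  · obtain ⟨h1, h2⟩ := hf.designNode_spec hn (Nat.zero_le n)
    refine le_antisymm (hinj _ h1 _ (by simp) ?_) h1.1
    rw [h2]; simp [cdf]
  · obtain ⟨h1, h2⟩ := hf.designNode_spec hn le_rfl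
    refine le_antisymm h1.2 (hinj _ (by simp) _ h1 ?_)
    rw [h2, div_self hn'.ne']
    exact hf.integral_eq_one.le
  · rw [div_div, mul_comm, ← div_div, div_le_iff₀ hC, mul_comm]
    exact (hstep i hi).2
  · rw [div_div, mul_comm, ← div_div, le_div_iff₀ hc, mul_comm]
    exact (hstep i hi).1

end Design

/-! ### The projection weights solve the normal equations -/

section ProjectionWeights

variable {R : ℝ → ℝ → ℝ} {K f : ℝ → ℝ} {x h : ℝ} {n : ℕ}

lemma Nonsingular.isUnit_det (hR : Nonsingular R) {T : Fin n → ℝ} (hT : Function.Injective T)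
    (hTI : ∀ i, T i ∈ Icc (0 : ℝ) 1) :
    IsUnit (Matrix.of fun i j => R (T i) (T j)).det := by
  have h := hR (Finset.univ.image T) (by
    intro t ht
    obtain ⟨i, -, rfl⟩ := Finset.mem_image.1 (Finset.mem_coe.1 ht)
    exact hTI i)
  have hb : Function.Bijective (fun i : Fin n =>
      (⟨T i, Finset.mem_image_of_mem T (Finset.mem_univ i)⟩ : Finset.univ.image T)) := by
    refine ⟨fun i j hij => hT (congrArg Subtype.val hij), fun ⟨t, ht⟩ => ?_⟩
    obtain ⟨i, -, rfl⟩ := Finset.mem_image.1 ht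
    exact ⟨i, rfl⟩
  rw [← Matrix.det_submatrix_equiv_self (Equiv.ofBijective _ hb)] at h
  exact h

/-- The weights of the estimator, indexed by the nodes `0, …, n`. -/
def nodeWeights (R : ℝ → ℝ → ℝ) (K f : ℝ → ℝ) (n : ℕ) (x h : ℝ) : ℕ → ℝ
  | 0 => 0
  | l + 1 => if hl : l < n then weights R K (designPoint f n) x h ⟨l, hl⟩ else 0

lemma sum_nodeWeights {E : Type*} [AddCommGroup E] [Module ℝ E] (q : ℝ → E) :
    ∑ l ∈ Finset.range (n + 1), nodeWeights R K f n x h l • q (designNode f n l) =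
      ∑ i, weights R K (designPoint f n) x h i • q (designPoint f n i) := by
  rw [Finset.sum_range_succ', nodeWeights, zero_smul, add_zero, ← Fin.sum_univ_eq_sum_range
    (fun l => nodeWeights R K f n x h (l + 1) • q (designNode f n (l + 1)))]
  exact Finset.sum_congr rfl fun i _ => by simp [nodeWeights, designPoint_eq]

lemma solvesNormalEquations_nodeWeights (hR : Nonsingular R) (hf : IsDesignDensity f) {c C : ℝ}
    (hτ : IsMesh (designNode f n) n c C) :
    SolvesNormalEquations R (phi K x h) (designNode f n) n (nodeWeights R K f n x h) := by
  have hinj : Function.Injective (designPoint f n) := by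
    intro i j hij
    rw [designPoint_eq, designPoint_eq] at hij
    by_contra hne
    exact hτ.ne_of_ne (i := i + 1) (l := j + 1) i.isLt j.isLt
      (fun he => hne (Fin.ext (by omega))) hij
  have hdet := hR.isUnit_det hinj fun i => hf.designPoint_mem i
  refine ⟨rfl, fun j hj0 hj => ?_⟩
  obtain ⟨l, rfl⟩ : ∃ l, j = l + 1 := ⟨j - 1, by omega⟩
  have hs := sum_nodeWeights (K := K) (R := R) (f := f) (x := x) (h := h) (n := n)
    (fun s => R s (designNode f n (l + 1)))
  simp only [smul_eq_mul] at hs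
  rw [hs]
  have hv : Matrix.vecMul (weights R K (designPoint f n) x h)
      (Matrix.of fun i j => R (designPoint f n i) (designPoint f n j)) =
      fun i => fxh R K x h (designPoint f n i) := by
    rw [weights, Matrix.vecMul_vecMul, Matrix.nonsing_inv_mul _ hdet, Matrix.vecMul_one]
  have hv' := congrFun hv ⟨l, hj⟩
  rw [designPoint_eq] at hv'
  rw [fxh] at hv'
  rw [← hv']
  simp [Matrix.vecMul, dotProduct, designPoint_eq]

lemma Nonsingular.diag_ne_zero (hR : Nonsingular R) {t : ℝ} (ht : t ∈ Icc (0 : ℝ) 1) :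
    R t t ≠ 0 := by
  have h := hR.isUnit_det (n := 1) (T := fun _ => t) (Function.injective_of_subsingleton _)
    fun _ => ht
  simpa using h

end ProjectionWeights

/-! ### The error processes -/

section Errors

variable {Ω : Type*} [MeasurableSpace Ω] {P : Measure Ω} {ε : ℕ → ℝ → Ω → ℝ} {R : ℝ → ℝ → ℝ}

namespace IsErrorSequence

lemma identDistrib_apply (hε : IsErrorSequence P ε R) (j : ℕ) {t : ℝ} (ht : t ∈ Icc (0 : ℝ) 1) :
    IdentDistrib (ε j t) (ε 0 t) P P :=
  (hε.ident j).comp (measurable_pi_apply (⟨t, ht⟩ : Icc (0 : ℝ) 1))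

lemma iIndepFun_apply (hε : IsErrorSequence P ε R) {t : ℝ} (ht : t ∈ Icc (0 : ℝ) 1) :
    iIndepFun (fun j => ε j t) P :=
  hε.indep.comp (fun _ y => y ⟨t, ht⟩) fun _ => measurable_pi_apply _

lemma variance_eq (hε : IsErrorSequence P ε R) {t : ℝ} (ht : t ∈ Icc (0 : ℝ) 1) :
    Var[ε 0 t; P] = R t t := by
  rw [← covariance_self (hε.measurable 0 t ht).aemeasurable, hε.cov_eq t ht t ht]

variable [IsProbabilityMeasure P]

/-- The central limit theorem for the errors at a single point. -/
lemma tendstoInDistribution_apply (hε : IsErrorSequence P ε R) {t : ℝ} (ht : t ∈ Icc (0 : ℝ) 1) :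
    TendstoInDistribution (fun (m : ℕ) ω => (√m)⁻¹ * ∑ j ∈ Finset.range m, ε j t ω) atTop
      (id : ℝ → ℝ) (fun _ => P) (gaussianReal 0 (R t t).toNNReal) := by
  have hlaw : HasLaw (id : ℝ → ℝ) (gaussianReal 0 Var[ε 0 t; P].toNNReal)
      (gaussianReal 0 (R t t).toNNReal) := by
    rw [hε.variance_eq ht]
    exact HasLaw.id
  have h := tendstoInDistribution_inv_sqrt_mul_sum_sub (X := fun j => ε j t) hlaw
    (hε.memLp t ht) (hε.iIndepFun_apply ht) fun j => hε.identDistrib_apply j ht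
  simpa [hε.centered t ht] using h

variable {n : ℕ} {T : Fin n → ℝ} {x : ℝ}

/-- The covariance of the errors is the Gram function of `k`: both sides expand into the same
quadratic form in `R`. -/
lemma variance_sum_sub {k : ℝ → H}
    {M : ℝ} (hε : IsErrorSequence P ε R) (hk : IsKernelFamily R k M)
    (hT : ∀ i, T i ∈ Icc (0 : ℝ) 1) (hx : x ∈ Icc (0 : ℝ) 1) (w : Fin n → ℝ) :
    Var[fun ω => ∑ i, w i * ε 0 (T i) ω - ε 0 x ω; P] = ‖∑ i, w i • k (T i) - k x‖ ^ 2 := by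
  have hL : ∀ i, MemLp (fun ω => w i * ε 0 (T i) ω) 2 P :=
    fun i => (hε.memLp _ (hT i)).const_mul _
  have hS : MemLp (fun ω => ∑ i, w i * ε 0 (T i) ω) 2 P := memLp_finsetSum _ fun i _ => hL i
  have hX := hε.memLp x hx
  rw [variance_fun_sub hS hX, variance_fun_sum hL, covariance_fun_sum_left hL hX,
    hε.variance_eq hx, norm_sub_sq_real, ← real_inner_self_eq_norm_sq,
    ← real_inner_self_eq_norm_sq, sum_inner, sum_inner, hk.inner_eq x hx x hx]
  congr 2
  · refine Finset.sum_congr rfl fun i _ => ?_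
    rw [inner_sum]
    refine Finset.sum_congr rfl fun j _ => ?_
    rw [covariance_const_mul_left, covariance_const_mul_right, hε.cov_eq _ (hT i) _ (hT j),
      real_inner_smul_left, real_inner_smul_right, hk.inner_eq _ (hT i) _ (hT j)]
  · congr 1
    refine Finset.sum_congr rfl fun i _ => ?_
    rw [covariance_const_mul_left, hε.cov_eq _ (hT i) _ hx, real_inner_smul_left,
      hk.inner_eq _ (hT i) _ hx]

/-- Chebyshev's inequality for the normalized sums of the prediction errors. -/
lemma measure_abs_sum_ge_le {k : ℝ → H}
    {M : ℝ} (hε : IsErrorSequence P ε R) (hk : IsKernelFamily R k M)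
    (hT : ∀ i, T i ∈ Icc (0 : ℝ) 1) (hx : x ∈ Icc (0 : ℝ) 1) (w : Fin n → ℝ) {m : ℕ} (hm : 0 < m)
    {δ : ℝ} (hδ : 0 < δ) :
    P {ω | δ ≤ |(√m)⁻¹ * ∑ j ∈ Finset.range m, (∑ i, w i * ε j (T i) ω - ε j x ω)|} ≤
      ENNReal.ofReal (‖∑ i, w i • k (T i) - k x‖ ^ 2 / δ ^ 2) := by
  set u : (Icc (0 : ℝ) 1 → ℝ) → ℝ := fun y => ∑ i, w i * y ⟨T i, hT i⟩ - y ⟨x, hx⟩ with hu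
  have hum : Measurable u := by fun_prop
  set Z : ℕ → Ω → ℝ := fun j ω => ∑ i, w i * ε j (T i) ω - ε j x ω with hZ
  have hident : ∀ j, IdentDistrib (Z j) (Z 0) P P := fun j => (hε.ident j).comp hum
  have hindep : iIndepFun Z P := hε.indep.comp (fun _ => u) fun _ => hum
  have hZ0 : MemLp (Z 0) 2 P := (memLp_finsetSum _ fun i _ =>
    (hε.memLp _ (hT i)).const_mul (w i)).sub (hε.memLp x hx)
  have hZL : ∀ j, MemLp (Z j) 2 P := fun j => (hident j).memLp_iff.2 hZ0
  have hmean0 : ∫ ω, Z 0 ω ∂P = 0 := by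
    have hi : ∀ t ∈ Icc (0 : ℝ) 1, Integrable (ε 0 t) P := fun t ht =>
      (hε.memLp t ht).integrable (by norm_num)
    simp only [hZ]
    rw [integral_sub (integrable_finsetSum _ fun i _ => (hi _ (hT i)).const_mul _) (hi x hx),
      integral_finsetSum _ fun i _ => (hi _ (hT i)).const_mul _, hε.centered x hx]
    simp [integral_const_mul, hε.centered _ (hT _)]
  have hmean : ∀ j, ∫ ω, Z j ω ∂P = 0 := fun j => (hident j).integral_eq.trans hmean0
  have hSL : MemLp (fun ω => (√m)⁻¹ * ∑ j ∈ Finset.range m, Z j ω) 2 P :=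
    (memLp_finsetSum _ fun j _ => hZL j).const_mul _
  have hSmean : ∫ ω, (√m)⁻¹ * ∑ j ∈ Finset.range m, Z j ω ∂P = 0 := by
    rw [integral_const_mul, integral_finsetSum _ fun j _ => (hZL j).integrable (by norm_num)]
    simp [hmean]
  have hSvar : Var[fun ω => (√m)⁻¹ * ∑ j ∈ Finset.range m, Z j ω; P] =
      ‖∑ i, w i • k (T i) - k x‖ ^ 2 := by
    have hm' : (0 : ℝ) < m := by exact_mod_cast hm
    have hsum := IndepFun.variance_sum (s := Finset.range m) (fun j _ => hZL j)
      fun i _ j _ hij => hindep.indepFun hij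
    rw [variance_const_mul, ← hε.variance_sum_sub hk hT hx w]
    rw [show (fun ω => ∑ j ∈ Finset.range m, Z j ω) = ∑ j ∈ Finset.range m, Z j by
      ext ω; simp, hsum, Finset.sum_congr rfl fun j _ => (hident j).variance_eq]
    rw [Finset.sum_const, Finset.card_range, nsmul_eq_mul, inv_pow, Real.sq_sqrt hm'.le,
      inv_mul_cancel_left₀ hm'.ne']
  have h := meas_ge_le_variance_div_sq hSL hδ
  simpa only [hSvar, hSmean, sub_zero] using h

end IsErrorSequence

end Errors

/-! ### Decomposition of the error, and the limits of its parts -/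

section Main

variable {Ω : Type*} [MeasurableSpace Ω] {P : Measure Ω} {ε : ℕ → ℝ → Ω → ℝ} {R : ℝ → ℝ → ℝ}
  {K f g : ℝ → ℝ}

lemma measurable_estimator (hε : IsErrorSequence P ε R) {n : ℕ} {T : Fin n → ℝ}
    (hT : ∀ i, T i ∈ Icc (0 : ℝ) 1) (m : ℕ) (h x : ℝ) :
    Measurable (estimator R K g ε T m h x) := by
  have h1 := fun j i => hε.measurable j (T i) (hT i)
  unfold estimator meanObs obs
  fun_prop

/-- The error of the estimator splits into the bias, the prediction error and the mean error at
`x`. -/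
lemma estimator_sub_eq {Ω : Type*} {ε : ℕ → ℝ → Ω → ℝ} {n : ℕ}
    (T : Fin n → ℝ) {m : ℕ} (hm : 0 < m) (h x : ℝ) (ω : Ω) :
    √m * (estimator R K g ε T m h x ω - g x) =
      √m * (∑ i, weights R K T x h i * g (T i) - g x) +
      (√m)⁻¹ * ∑ j ∈ Finset.range m, (∑ i, weights R K T x h i * ε j (T i) ω - ε j x ω) +
      (√m)⁻¹ * ∑ j ∈ Finset.range m, ε j x ω := by
  have hm' : (0 : ℝ) < m := by exact_mod_cast hm
  have hs : (√m)⁻¹ = √m * (1 / m) := by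
    rw [inv_eq_one_div, mul_one_div, div_eq_div_iff (Real.sqrt_pos.2 hm').ne' hm'.ne', one_mul,
      Real.mul_self_sqrt hm'.le]
  have he : estimator R K g ε T m h x ω = ∑ i, weights R K T x h i * g (T i) +
      1 / m * ∑ j ∈ Finset.range m, ∑ i, weights R K T x h i * ε j (T i) ω := by
    rw [Finset.sum_comm, Finset.mul_sum, ← Finset.sum_add_distrib, estimator]
    refine Finset.sum_congr rfl fun i _ => ?_
    simp only [meanObs, obs, Finset.sum_add_distrib, ← Finset.mul_sum, Finset.sum_const,
      Finset.card_range, nsmul_eq_mul]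
    field_simp
  rw [he, hs, Finset.sum_sub_distrib]
  ring

lemma tendsto_norm_sum_weights {k : ℝ → H} {M : ℝ} (hk : IsKernelFamily R k M)
    (hR : Nonsingular R) (hA : AssumptionA R)
    (hK : IsFirstOrderKernel K) (hf : IsDesignDensity f) {n : ℕ → ℕ} {h : ℕ → ℝ}
    (hn : Tendsto n atTop atTop) (hh : ∀ k, 0 < h k) (hh0 : Tendsto h atTop (𝓝 0))
    {x : ℝ} (hx : x ∈ Ioo (0 : ℝ) 1) :
    Tendsto (fun l => ‖∑ i, weights R K (designPoint f (n l)) x (h l) i •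
      k (designPoint f (n l) i) - k x‖) atTop (𝓝 0) := by
  obtain ⟨c, C, hmesh⟩ := hf.exists_isMesh
  obtain ⟨D, hD⟩ := exists_norm_nodeComb_sub_le hk hA hK x c C
  have hn1 : Tendsto (fun l => 1 / (n l : ℝ)) atTop (𝓝 0) :=
    tendsto_one_div_atTop_nhds_zero_nat.comp hn
  have hnC : Tendsto (fun l => h l + C / (n l : ℝ)) atTop (𝓝 0) := by
    have := hh0.add (hn1.const_mul C)
    simpa [div_eq_mul_inv] using this
  rw [Metric.tendsto_nhds]
  intro e he
  -- Both 1/n and the oscillation of k near x will be at most η, and 2η(|D| + 1) = e.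
  set η := e / (2 * (|D| + 1)) with hη
  have hD1 : 0 < |D| + 1 := by positivity
  have hη0 : 0 < η := by positivity
  obtain ⟨r, hr, hball⟩ := Metric.eventually_nhds_iff.1
    ((hk.tendsto_norm_sub hA hx).eventually (Iio_mem_nhds hη0))
  filter_upwards [hn.eventually_gt_atTop 0, hn1.eventually (Iio_mem_nhds hη0),
    hnC.eventually (Iio_mem_nhds hr), hnC.eventually (Iio_mem_nhds hx.1),
    hh0.eventually (Iio_mem_nhds (sub_pos.2 hx.2))] with l h1 h2 h3 h4 h5
  have hτ := hmesh (n l) h1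
  have hb := hD (designNode f (n l)) (n l) (h l) (nodeWeights R K f (n l) x (h l)) η hτ (hh l)
    (by linarith) (by linarith)
    (solvesNormalEquations_nodeWeights hR hf hτ)
    (fun s hs => (hball (y := s) (by rw [Real.dist_eq]; exact hs.trans_lt h3)).le)
  rw [nodeComb, sum_nodeWeights] at hb
  rw [dist_zero_right, norm_norm]
  calc _ ≤ D * (1 / (n l : ℝ) + η) := hb
    _ ≤ |D| * (η + η) := by
      have : 0 ≤ 1 / (n l : ℝ) + η := by positivity
      exact mul_le_mul (le_abs_self D) (by linarith) this (abs_nonneg D)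
    _ < (|D| + 1) * (η + η) := by nlinarith
    _ = e := by rw [hη]; field_simp; ring

lemma tendsto_bias {k : ℝ → H} {M : ℝ} (hk : IsKernelFamily R k M)
    (hR : Nonsingular R) (hA : AssumptionA R)
    (hB : AssumptionB R) (hK : IsFirstOrderKernel K) (hg : ContDiffOn ℝ 2 g (Icc 0 1))
    (hf : IsDesignDensity f) {n m : ℕ → ℕ} {h : ℕ → ℝ}
    (hn : Tendsto n atTop atTop) (hh : ∀ k, 0 < h k) (hh0 : Tendsto h atTop (𝓝 0))
    (hnh2 : Tendsto (fun k => (n k : ℝ) * h k ^ 2) atTop atTop)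
    (hmh2 : Tendsto (fun k => √(m k) * h k ^ 2) atTop (𝓝 0))
    {x : ℝ} (hx : x ∈ Ioo (0 : ℝ) 1) :
    Tendsto (fun l => √(m l) * (∑ i, weights R K (designPoint f (n l)) x (h l) i *
      g (designPoint f (n l) i) - g x)) atTop (𝓝 0) := by
  obtain ⟨c, C, hmesh⟩ := hf.exists_isMesh
  obtain ⟨D, hD⟩ := exists_bias_le hk hA hB (hR.diag_ne_zero (by simp)) hK hg hx c C
  have hn1 : Tendsto (fun l => 1 / (n l : ℝ)) atTop (𝓝 0) :=
    tendsto_one_div_atTop_nhds_zero_nat.comp hn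
  have hnC : Tendsto (fun l => h l + C / (n l : ℝ)) atTop (𝓝 0) := by
    have := hh0.add (hn1.const_mul C)
    simpa [div_eq_mul_inv] using this
  -- The bound √m (1/n + h²), with √m/n written as √m h² divided by n h² to bring in the two
  -- bandwidth conditions.
  have hlim : Tendsto (fun l => D * (√(m l) * h l ^ 2 / (n l * h l ^ 2) + √(m l) * h l ^ 2)) atTop
      (𝓝 0) := by
    simpa using ((hmh2.div_atTop hnh2).add hmh2).const_mul D
  refine squeeze_zero_norm' ?_ hlim
  filter_upwards [hn.eventually_gt_atTop 0, hnC.eventually (Iio_mem_nhds hx.1),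
    hh0.eventually (Iio_mem_nhds (sub_pos.2 hx.2))] with l h1 h4 h5
  have hτ := hmesh (n l) h1
  have hb := hD (designNode f (n l)) (n l) (h l) (nodeWeights R K f (n l) x (h l)) hτ (hh l)
    (by linarith) (by linarith)
    (solvesNormalEquations_nodeWeights hR hf hτ)
  have hs := sum_nodeWeights (R := R) (K := K) (f := f) (n := n l) (x := x) (h := h l) g
  simp only [smul_eq_mul] at hs
  rw [hs] at hb
  rw [norm_mul, Real.norm_of_nonneg (Real.sqrt_nonneg _), Real.norm_eq_abs]
  refine (mul_le_mul_of_nonneg_left hb (Real.sqrt_nonneg _)).trans_eq ?_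
  have := (hh l).ne'
  field_simp

end Main

end ProjEst

end

theorem mainTheorem3 {Ω : Type*} [MeasurableSpace Ω] (P : Measure Ω) [IsProbabilityMeasure P]
    (ε : ℕ → ℝ → Ω → ℝ) (R : ℝ → ℝ → ℝ) (K f g : ℝ → ℝ)
    (hε : ProjEst.IsErrorSequence P ε R) (hR : ProjEst.Nonsingular R)
    (hA : ProjEst.AssumptionA R) (hB : ProjEst.AssumptionB R) (hC : ProjEst.AssumptionC R)
    (hK : ProjEst.IsFirstOrderKernel K) (hD : ProjEst.AssumptionD K)
    (hg : ContDiffOn ℝ 2 g (Icc 0 1)) (hf : ProjEst.IsDesignDensity f)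
    (n m : ℕ → ℕ) (h : ℕ → ℝ)
    (hn : Tendsto n atTop atTop) (hm : Tendsto m atTop atTop)
    (hh : ∀ k, h k ∈ Ioo (0 : ℝ) 1) (hh0 : Tendsto h atTop (𝓝 0))
    (hnh : Tendsto (fun k => (n k : ℝ) * h k) atTop atTop)
    (hnm : (fun k => (n k : ℝ) / (m k : ℝ)) =O[atTop] (fun _ => (1 : ℝ)))
    (hnh2 : Tendsto (fun k => (n k : ℝ) * h k ^ 2) atTop atTop)
    (hmh2 : Tendsto (fun k => Real.sqrt (m k) * h k ^ 2) atTop (𝓝 0))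
    (x : ℝ) (hx : x ∈ Ioo (0 : ℝ) 1) :
    TendstoInDistribution
      (fun k ω => Real.sqrt (m k) *
        (ProjEst.estimator R K g ε (ProjEst.designPoint f (n k)) (m k) (h k) x ω - g x))
      atTop (id : ℝ → ℝ) (fun _ => P) (gaussianReal 0 (R x x).toNNReal) := by
  obtain ⟨H, _, _, κ, M, hκ⟩ := hC.exists_isKernelFamily
  have hxI := Ioo_subset_Icc_self hx
  have hclt := hε.tendstoInDistribution_apply hxI
  have hclt' : TendstoInDistribution
      (fun l ω => (√(m l))⁻¹ * ∑ j ∈ Finset.range (m l), ε j x ω) atTop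
      (id : ℝ → ℝ) (fun _ => P) (gaussianReal 0 (R x x).toNNReal) :=
    ⟨fun l => hclt.forall_aemeasurable (m l), hclt.aemeasurable_limit, hclt.tendsto.comp hm⟩
  -- Slutsky's argument: it remains to show that the bias plus the prediction error tends to 0 in
  -- measure.
  refine tendstoInDistribution_of_tendstoInMeasure_sub _ _ hclt' ?_ fun l =>
    (((ProjEst.measurable_estimator hε (fun i => hf.designPoint_mem i) _ _ _).sub_const
      _).const_mul _).aemeasurable
  have hbias := ProjEst.tendsto_bias (m := m) hκ hR hA hB hK hg hf hn (fun l => (hh l).1) hh0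
    hnh2 hmh2 hx
  have hnorm := ProjEst.tendsto_norm_sum_weights hκ hR hA hK hf hn (fun l => (hh l).1) hh0 hx
  rw [tendstoInMeasure_iff_norm]
  intro δ hδ
  have hδ2 : 0 < δ / 2 := half_pos hδ
  have hlim := ENNReal.tendsto_ofReal ((hnorm.pow 2).div_const ((δ / 2) ^ 2))
  simp only [ne_eq, OfNat.ofNat_ne_zero, not_false_eq_true, zero_pow, zero_div,
    ENNReal.ofReal_zero] at hlim
  refine tendsto_of_tendsto_of_tendsto_of_le_of_le' tendsto_const_nhds hlim
    (Eventually.of_forall fun _ => zero_le) ?_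
  -- The deterministic bias is eventually below δ/2, so a total of at least δ forces the prediction
  -- error to exceed δ/2, where Chebyshev's bound applies.
  filter_upwards [hm.eventually_gt_atTop 0, hbias.norm.eventually 
      (Iio_mem_nhds (show ‖(0 : ℝ)‖ < δ / 2 by simpa using hδ2))]
    with l hml hbl
  refine (measure_mono fun ω hω => ?_).trans (hε.measure_abs_sum_ge_le hκ
    (fun i => hf.designPoint_mem i) hxI
    (ProjEst.weights R K (ProjEst.designPoint f (n l)) x (h l)) hml hδ2)
  rw [mem_ofPred_eq, Pi.sub_apply, Pi.sub_apply, Pi.zero_apply, sub_zero,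
    ProjEst.estimator_sub_eq _ hml, add_sub_cancel_right] at hω
  have := hω.trans (norm_add_le _ _)
  rw [mem_ofPred_eq, ← Real.norm_eq_abs]
  linarith
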